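/- **Theorem (EBM to protocol).** All Hilbert spaces are finite-dimensional and complex, and $X\preceq Y$ means that $Y-X$ is positive semidefinite. *Point games.* For a positive semidefinite matrix $Z$ and a vector $\psi$ let $\mathrm{prob}[Z,\psi]:[0,\infty)\to[0,\infty)$ be $z\mapsto\langle\psi|\Pi^{[z]}|\psi\rangle$, where $\Pi^{[z]}$ is the orthogonal projector onto the eigenspace of $Z$ for $z$ (so the value is $0$ if $z$ is not an eigenvalue). For functions $l,r:[0,\infty)\to[0,\infty)$ of finite support, the line transition $l\to r$ is *expressible by matrices* (EBM) if there are matrices $0\preceq X\preceq Y$ and a (not necessarily unit) vector $\psi$ with $l=\mathrm{prob}[X,\psi]$ and $r=\mathrm{prob}[Y,\psi]$. For finitely supported $p,q:[0,\infty)^2\to[0,\infty)$, the transition $p\to q$ is EBM horizontal (resp. vertical) if $p(\cdot,y)\to q(\cdot,y)$ is EBM for all $y\ge 0$ (resp. $p(x,\cdot)\to q(x,\cdot)$ is EBM for all $x\ge 0$). Write $[x,y]$ for the indicator function of the point $(x,y)$. An *EBM point game with final point $[\beta,\alpha]$* is a sequence $p_0,\dots,p_n$ of finitely supported functions with $p_0=\frac12[0,1]+\frac12[1,0]$,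 $p_n=1[\beta,\alpha]$, and $p_i\to p_{i+1}$ EBM vertical for even $i$ and EBM horizontal for odd $i$ ($0\le i<n$). *Protocols.* For $N$ even, an $N$-message weak coin flipping (WCF) protocol consists of spaces $\mathcal A,\mathcal M,\mathcal B$; unit vectors $\psi_{A,0},\psi_{M,0},\psi_{B,0}$ in them, with $\psi_0=\psi_{A,0}\otimes\psi_{M,0}\otimes\psi_{B,0}$; for $1\le i\le N$ a unitary $U_i$ and an orthogonal projector $E_i$ on $\mathcal A\otimes\mathcal M\otimes\mathcal B$, of the form $U_i=U_{A,i}\otimes I_{\mathcal B}$, $E_i=E_{A,i}\otimes I_{\mathcal B}$ for $i$ odd and $U_i=I_{\mathcal A}\otimes U_{B,i}$, $E_i=I_{\mathcal A}\otimes E_{B,i}$ for $i$ even, with $E_i\psi_i=\psi_i$ for the honest states $\psi_i=U_i\cdots U_1\psi_0$; and POVMs $\{\Pi_A^{(0)},\Pi_A^{(1)}\}$ on $\mathcal A$, $\{\Pi_B^{(0)},\Pi_B^{(1)}\}$ on $\mathcal B$, such that $(\Pi_A^{(0)}\otimes I\otimes\Pi_B^{(1)})\psi_N=(\Pi_A^{(1)}\otimes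 I\otimes\Pi_B^{(0)})\psi_N=0$ and $\|(\Pi_A^{(0)}\otimes I\otimes\Pi_B^{(0)})\psi_N\|^2=\|(\Pi_A^{(1)}\otimes I\otimes\Pi_B^{(1)})\psi_N\|^2=\frac12$. Alice prepares $\psi_{A,0}\otimes\psi_{M,0}$ and Bob $\psi_{B,0}$; in round $i$ Alice ($i$ odd) or Bob ($i$ even) applies $U_i$, measures $\{E_i,I-E_i\}$, declares herself/himself the winner on the second outcome and sends the message register on the first; at the end both measure their POVM, Alice winning on $0$ and Bob on $1$. *Cheating probabilities.* $P_B^*$ is the supremum, over all strategies of a cheating Bob (an arbitrary workspace, an initial state of it, and arbitrary quantum operations on message space and workspace in the even rounds), of the probability that honest Alice passes all her tests $E_i$ and outputs $1$. $P_A^*$ is the supremum, over all strategies of a cheating Alice (who prepares an arbitrary joint state of her workspace and the message space and applies arbitrary quantum operations to them in the odd rounds), of the probability that honest Bob passes all his tests and outputs $0$. The corresponding semidefinite programs are as follows. For $P_B^*$: the supremum of $\mathrm{Tr}((\Pi_A^{(1)}\otimes I)\rho_N)$ over $\rho_0,\dots,\rho_N\succeq0$ on $\mathcal A\otimes\mathcal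 M$ with $\mathrm{Tr}_{\mathcal M}\rho_0=|\psi_{A,0}\rangle\langle\psi_{A,0}|$, $\mathrm{Tr}_{\mathcal M}\rho_i=\mathrm{Tr}_{\mathcal M}(E_{A,i}U_{A,i}\rho_{i-1}U_{A,i}^\dagger E_{A,i})$ for $i$ odd and $\mathrm{Tr}_{\mathcal M}\rho_i=\mathrm{Tr}_{\mathcal M}\rho_{i-1}$ for $i$ even. For $P_A^*$: the supremum of $\mathrm{Tr}((I\otimes\Pi_B^{(0)})\rho_N)$ over $\rho_0,\dots,\rho_N\succeq0$ on $\mathcal M\otimes\mathcal B$ with $\mathrm{Tr}_{\mathcal M}\rho_0=|\psi_{B,0}\rangle\langle\psi_{B,0}|$, $\mathrm{Tr}_{\mathcal M}\rho_i=\mathrm{Tr}_{\mathcal M}(E_{B,i}U_{B,i}\rho_{i-1}U_{B,i}^\dagger E_{B,i})$ for $i$ even and $\mathrm{Tr}_{\mathcal M}\rho_i=\mathrm{Tr}_{\mathcal M}\rho_{i-1}$ for $i$ odd. *Dual feasible points.* Matrices $Z_{A,0},\dots,Z_{A,N}\succeq0$ on $\mathcal A$ form a dual feasible point with eigenvalue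 $\beta>0$ if $Z_{A,i-1}\otimes I_{\mathcal M}\succeq U_{A,i}^\dagger E_{A,i}(Z_{A,i}\otimes I_{\mathcal M})E_{A,i}U_{A,i}$ for $i$ odd, $Z_{A,i-1}=Z_{A,i}$ for $i$ even, $Z_{A,N}=\Pi_A^{(1)}$ and $Z_{A,0}\psi_{A,0}=\beta\psi_{A,0}$. Matrices $Z_{B,0},\dots,Z_{B,N}\succeq0$ on $\mathcal B$ form a dual feasible point with eigenvalue $\alpha>0$ if $I_{\mathcal M}\otimes Z_{B,i-1}\succeq U_{B,i}^\dagger E_{B,i}(I_{\mathcal M}\otimes Z_{B,i})E_{B,i}U_{B,i}$ for $i$ even, $Z_{B,i-1}=Z_{B,i}$ for $i$ odd, $Z_{B,N}=\Pi_B^{(0)}$ and $Z_{B,0}\psi_{B,0}=\alpha\psi_{B,0}$. *Statement.* Given an EBM point game with final point $[\beta,\alpha]$, there exist a WCF protocol, a dual feasible point $\{Z_{A,i}\}$ with eigenvalue $\beta$ and a dual feasible point $\{Z_{B,i}\}$ with eigenvalue $\alpha$, and for this protocol $P_A^*\le\alpha$ and $P_B^*\le\beta$; moreover the values of the two semidefinite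 programs above are at most $\alpha$ and $\beta$, respectively. -/

import Mathlib

open scoped NNReal Kronecker ComplexOrder

noncomputable section

namespace WCF

/-! ## Point games with transitions expressible by matrices -/

/-- `prob[Z, ψ](z) = ⟨ψ| Π^[z] |ψ⟩`, with `Π^[z]` the orthogonal projector onto the eigenspace of
`Z` for `z`. If `z` is not an eigenvalue, the eigenspace is trivial and the value is `0`. -/
def prob {d : ℕ} (Z : Matrix (Fin d) (Fin d) ℂ) (ψ : EuclideanSpace ℂ (Fin d)) (z : ℝ≥0) : ℝ :=
  (inner ℂ ψ
    ((Module.End.eigenspace (Matrix.toEuclideanLin Z) ((z : ℝ) : ℂ)).starProjection ψ)).re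

/-- The line transition `l → r` is expressible by matrices: `l = prob[X, ψ]`, `r = prob[Y, ψ]`
for some matrices `0 ⪯ X ⪯ Y` and a (not necessarily unit) vector `ψ`. -/
def EBMLine (l r : ℝ≥0 → ℝ≥0) : Prop :=
  ∃ (d : ℕ) (X Y : Matrix (Fin d) (Fin d) ℂ) (ψ : EuclideanSpace ℂ (Fin d)),
    X.PosSemidef ∧ (Y - X).PosSemidef ∧
      (∀ z, (l z : ℝ) = prob X ψ z) ∧ (∀ z, (r z : ℝ) = prob Y ψ z)

/-- Horizontal EBM transition: EBM along every horizontal line. -/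
def EBMHorizontal (p q : ℝ≥0 × ℝ≥0 →₀ ℝ≥0) : Prop :=
  ∀ y : ℝ≥0, EBMLine (fun x => p (x, y)) (fun x => q (x, y))

/-- Vertical EBM transition: EBM along every vertical line. -/
def EBMVertical (p q : ℝ≥0 × ℝ≥0 →₀ ℝ≥0) : Prop :=
  ∀ x : ℝ≥0, EBMLine (fun y => p (x, y)) (fun y => q (x, y))

/-- `p 0, …, p n` is an EBM point game with final point `[β, α]`. -/
structure IsEBMPointGame (n : ℕ) (p : ℕ → (ℝ≥0 × ℝ≥0 →₀ ℝ≥0)) (β α : ℝ≥0) : Prop where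
  init : p 0 = Finsupp.single (0, 1) (1 / 2) + Finsupp.single (1, 0) (1 / 2)
  vertical : ∀ i < n, Even i → EBMVertical (p i) (p (i + 1))
  horizontal : ∀ i < n, Odd i → EBMHorizontal (p i) (p (i + 1))
  final : p n = Finsupp.single (β, α) 1

/-! ## Tensor products

The finite-dimensional spaces are `ℂ^A`, `ℂ^M`, `ℂ^B` for finite index types; their tensor product
has index type `A × M × B`. -/

section Tensor

variable {A M B : Type}

/-- Identification of operators on `(𝒜 ⊗ ℳ) ⊗ ℬ` with operators on `𝒜 ⊗ ℳ ⊗ ℬ`. -/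
def assocOp (X : Matrix ((A × M) × B) ((A × M) × B) ℂ) :
    Matrix (A × M × B) (A × M × B) ℂ :=
  Matrix.reindex (Equiv.prodAssoc A M B) (Equiv.prodAssoc A M B) X

/-- `X ⊗ I_ℬ` for `X` acting on `𝒜 ⊗ ℳ`. -/
def liftAM [DecidableEq B] (X : Matrix (A × M) (A × M) ℂ) : Matrix (A × M × B) (A × M × B) ℂ :=
  assocOp (X ⊗ₖ (1 : Matrix B B ℂ))

/-- `I_𝒜 ⊗ X` for `X` acting on `ℳ ⊗ ℬ`. -/
def liftMB [DecidableEq A] (X : Matrix (M × B) (M × B) ℂ) : Matrix (A × M × B) (A × M × B) ℂ :=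
  (1 : Matrix A A ℂ) ⊗ₖ X

/-- `tr_ℳ` of an operator on `𝒜 ⊗ ℳ`. -/
def traceMRight [Fintype M] (ρ : Matrix (A × M) (A × M) ℂ) : Matrix A A ℂ :=
  fun a a' => ∑ m, ρ (a, m) (a', m)

/-- `tr_ℳ` of an operator on `ℳ ⊗ ℬ`. -/
def traceMLeft [Fintype M] (ρ : Matrix (M × B) (M × B) ℂ) : Matrix B B ℂ :=
  fun b b' => ∑ m, ρ (m, b) (m, b')

/-- `|v⟩⟨v|`. -/
def ketbra (v : A → ℂ) : Matrix A A ℂ := Matrix.vecMulVec v (star v)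

/-- `‖v‖²` (Euclidean norm). -/
def normSq [Fintype A] (v : A → ℂ) : ℝ := ∑ x, ‖v x‖ ^ 2

end Tensor

/-! ## Weak coin flipping protocols -/

/-- The data of a protocol on `𝒜 ⊗ ℳ ⊗ ℬ`. In an `n`-message protocol `UA i`, `EA i` are used for
odd `1 ≤ i ≤ n` and `UB i`, `EB i` for even `1 ≤ i ≤ n`; other entries are irrelevant. -/
structure Scheme (A M B : Type) where
  ψA : A → ℂ
  ψM : M → ℂ
  ψB : B → ℂ
  UA : ℕ → Matrix (A × M) (A × M) ℂ
  UB : ℕ → Matrix (M × B) (M × B) ℂ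
  EA : ℕ → Matrix (A × M) (A × M) ℂ
  EB : ℕ → Matrix (M × B) (M × B) ℂ
  /-- Alice's final POVM. -/
  povmA : Fin 2 → Matrix A A ℂ
  /-- Bob's final POVM. -/
  povmB : Fin 2 → Matrix B B ℂ

namespace Scheme

variable {A M B : Type} [Fintype A] [Fintype M] [Fintype B]
  [DecidableEq A] [DecidableEq M] [DecidableEq B] (P : Scheme A M B)

/-- `U_i`: `U_{A,i} ⊗ I_ℬ` for `i` odd, `I_𝒜 ⊗ U_{B,i}` for `i` even. -/
def U (i : ℕ) : Matrix (A × M × B) (A × M × B) ℂ :=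
  if Odd i then liftAM (P.UA i) else liftMB (P.UB i)

/-- `E_i`: `E_{A,i} ⊗ I_ℬ` for `i` odd, `I_𝒜 ⊗ E_{B,i}` for `i` even. -/
def E (i : ℕ) : Matrix (A × M × B) (A × M × B) ℂ :=
  if Odd i then liftAM (P.EA i) else liftMB (P.EB i)

/-- The honest states `ψ_i = U_i ⋯ U_1 (ψ_{A,0} ⊗ ψ_{M,0} ⊗ ψ_{B,0})`. -/
def honest : ℕ → (A × M × B → ℂ)
  | 0 => fun x => P.ψA x.1 * P.ψM x.2.1 * P.ψB x.2.2
  | i + 1 => (P.U (i + 1)).mulVec (honest i)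

/-- `Π_A^{(a)} ⊗ I_ℳ ⊗ Π_B^{(b)}`. -/
def outcome (a b : Fin 2) : Matrix (A × M × B) (A × M × B) ℂ :=
  P.povmA a ⊗ₖ ((1 : Matrix M M ℂ) ⊗ₖ P.povmB b)

/-- The scheme is an `n`-message weak coin flipping protocol: correct and balanced. -/
structure IsProtocol (n : ℕ) : Prop where
  even : Even n
  ψA_unit : normSq P.ψA = 1
  ψM_unit : normSq P.ψM = 1
  ψB_unit : normSq P.ψB = 1
  UA_unitary : ∀ i, 1 ≤ i → i ≤ n → Odd i → P.UA i ∈ Matrix.unitaryGroup (A × M) ℂ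
  UB_unitary : ∀ i, 1 ≤ i → i ≤ n → Even i → P.UB i ∈ Matrix.unitaryGroup (M × B) ℂ
  EA_proj : ∀ i, 1 ≤ i → i ≤ n → Odd i → IsStarProjection (P.EA i)
  EB_proj : ∀ i, 1 ≤ i → i ≤ n → Even i → IsStarProjection (P.EB i)
  E_honest : ∀ i, 1 ≤ i → i ≤ n → (P.E i).mulVec (P.honest i) = P.honest i
  povmA_pos : ∀ c, (P.povmA c).PosSemidef
  povmA_sum : P.povmA 0 + P.povmA 1 = 1
  povmB_pos : ∀ c, (P.povmB c).PosSemidef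
  povmB_sum : P.povmB 0 + P.povmB 1 = 1
  correct01 : (P.outcome 0 1).mulVec (P.honest n) = 0
  correct10 : (P.outcome 1 0).mulVec (P.honest n) = 0
  balanced_A : normSq ((P.outcome 0 0).mulVec (P.honest n)) = 1 / 2
  balanced_B : normSq ((P.outcome 1 1).mulVec (P.honest n)) = 1 / 2

end Scheme

/-! ## Cheating strategies and cheating probabilities -/

/-- A strategy of a cheating Bob: a finite-dimensional workspace, an initial state of it, and for
every round a quantum operation (in Kraus form) on message space and workspace. -/
structure BobStrategy (M : Type) [Fintype M] [DecidableEq M] where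
  d : ℕ
  σ : Matrix (Fin d) (Fin d) ℂ
  σ_pos : σ.PosSemidef
  σ_trace : σ.trace = 1
  κ : ℕ
  K : ℕ → Fin κ → Matrix (M × Fin d) (M × Fin d) ℂ
  K_tp : ∀ i, ∑ k, (K i k).conjTranspose * K i k = 1

/-- A strategy of a cheating Alice. She holds the message space at the beginning, so she prepares
an arbitrary joint state of her workspace and the message space. -/
structure AliceStrategy (M : Type) [Fintype M] [DecidableEq M] where
  d : ℕ
  σ : Matrix (Fin d × M) (Fin d × M) ℂ
  σ_pos : σ.PosSemidef
  σ_trace : σ.trace = 1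
  κ : ℕ
  K : ℕ → Fin κ → Matrix (Fin d × M) (Fin d × M) ℂ
  K_tp : ∀ i, ∑ k, (K i k).conjTranspose * K i k = 1

namespace Scheme

variable {A M B : Type} [Fintype A] [Fintype M] [Fintype B]
  [DecidableEq A] [DecidableEq M] [DecidableEq B] (P : Scheme A M B)

/-- The unnormalized global state after message `i` when Alice is honest (and has not caught Bob
so far) and Bob plays the strategy `s`. -/
def stateVsBob (s : BobStrategy M) : ℕ → Matrix (A × M × Fin s.d) (A × M × Fin s.d) ℂ
  | 0 => ketbra P.ψA ⊗ₖ (ketbra P.ψM ⊗ₖ s.σ)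
  | i + 1 =>
    if Odd (i + 1) then
      liftAM (P.EA (i + 1) * P.UA (i + 1)) * stateVsBob s i *
        (liftAM (P.EA (i + 1) * P.UA (i + 1))).conjTranspose
    else
      ∑ k, liftMB (s.K (i + 1) k) * stateVsBob s i * (liftMB (s.K (i + 1) k)).conjTranspose

/-- The unnormalized global state after message `i` when Bob is honest (and has not caught Alice
so far) and Alice plays the strategy `s`. -/
def stateVsAlice (s : AliceStrategy M) : ℕ → Matrix (Fin s.d × M × B) (Fin s.d × M × B) ℂ
  | 0 => assocOp (s.σ ⊗ₖ ketbra P.ψB)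
  | i + 1 =>
    if Odd (i + 1) then
      ∑ k, liftAM (s.K (i + 1) k) * stateVsAlice s i * (liftAM (s.K (i + 1) k)).conjTranspose
    else
      liftMB (P.EB (i + 1) * P.UB (i + 1)) * stateVsAlice s i *
        (liftMB (P.EB (i + 1) * P.UB (i + 1))).conjTranspose

/-- `P_B^*` of the `n`-message protocol: the supremum, over all strategies of a cheating Bob, of the
probability that honest Alice never catches him and outputs `1`. -/
def cheatB (n : ℕ) : EReal :=
  ⨆ s : BobStrategy M,
    (((P.povmA 1 ⊗ₖ (1 : Matrix (M × Fin s.d) (M × Fin s.d) ℂ)) *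
      P.stateVsBob s n).trace.re : EReal)

/-- `P_A^*` of the `n`-message protocol: the supremum, over all strategies of a cheating Alice, of
the probability that honest Bob never catches her and outputs `0`. -/
def cheatA (n : ℕ) : EReal :=
  ⨆ s : AliceStrategy M,
    (((liftMB ((1 : Matrix M M ℂ) ⊗ₖ P.povmB 0) : Matrix (Fin s.d × M × B) (Fin s.d × M × B) ℂ) *
      P.stateVsAlice s n).trace.re : EReal)

/-! ## The semidefinite programs -/

/-- The constraints of the primal program for cheating Bob, on the states `ρ_{AM,i}`. -/
structure PrimalB (n : ℕ) (ρ : ℕ → Matrix (A × M) (A × M) ℂ) : Prop where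
  pos : ∀ i ≤ n, (ρ i).PosSemidef
  init : traceMRight (ρ 0) = ketbra P.ψA
  odd : ∀ i < n, Odd (i + 1) → traceMRight (ρ (i + 1)) =
    traceMRight (P.EA (i + 1) * P.UA (i + 1) * ρ i *
      (P.UA (i + 1)).conjTranspose * P.EA (i + 1))
  even : ∀ i < n, Even (i + 1) → traceMRight (ρ (i + 1)) = traceMRight (ρ i)

/-- The constraints of the primal program for cheating Alice, on the states `ρ_{MB,i}`. -/
structure PrimalA (n : ℕ) (ρ : ℕ → Matrix (M × B) (M × B) ℂ) : Prop where
  pos : ∀ i ≤ n, (ρ i).PosSemidef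
  init : traceMLeft (ρ 0) = ketbra P.ψB
  even : ∀ i < n, Even (i + 1) → traceMLeft (ρ (i + 1)) =
    traceMLeft (P.EB (i + 1) * P.UB (i + 1) * ρ i *
      (P.UB (i + 1)).conjTranspose * P.EB (i + 1))
  odd : ∀ i < n, Odd (i + 1) → traceMLeft (ρ (i + 1)) = traceMLeft (ρ i)

/-- Value of the primal program for cheating Bob. -/
def primalValueB (n : ℕ) : EReal :=
  ⨆ (ρ : ℕ → Matrix (A × M) (A × M) ℂ) (_ : P.PrimalB n ρ),
    (((P.povmA 1 ⊗ₖ (1 : Matrix M M ℂ)) * ρ n).trace.re : EReal)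

/-- Value of the primal program for cheating Alice. -/
def primalValueA (n : ℕ) : EReal :=
  ⨆ (ρ : ℕ → Matrix (M × B) (M × B) ℂ) (_ : P.PrimalA n ρ),
    ((((1 : Matrix M M ℂ) ⊗ₖ P.povmB 0) * ρ n).trace.re : EReal)

/-- `Z_{A,0}, …, Z_{A,n}` is a dual feasible point with `Z_{A,0} ψ_{A,0} = β ψ_{A,0}`, `β > 0`. -/
structure DualFeasibleA (n : ℕ) (Z : ℕ → Matrix A A ℂ) (β : ℝ) : Prop where
  pos : ∀ i ≤ n, (Z i).PosSemidef
  odd : ∀ i < n, Odd (i + 1) →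
    (Z i ⊗ₖ (1 : Matrix M M ℂ) - (P.UA (i + 1)).conjTranspose * P.EA (i + 1) *
      (Z (i + 1) ⊗ₖ (1 : Matrix M M ℂ)) * P.EA (i + 1) * P.UA (i + 1)).PosSemidef
  even : ∀ i < n, Even (i + 1) → Z i = Z (i + 1)
  final : Z n = P.povmA 1
  eigenvalue_pos : 0 < β
  eigenvector : (Z 0).mulVec P.ψA = (β : ℂ) • P.ψA

/-- `Z_{B,0}, …, Z_{B,n}` is a dual feasible point with `Z_{B,0} ψ_{B,0} = α ψ_{B,0}`, `α > 0`. -/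
structure DualFeasibleB (n : ℕ) (Z : ℕ → Matrix B B ℂ) (α : ℝ) : Prop where
  pos : ∀ i ≤ n, (Z i).PosSemidef
  even : ∀ i < n, Even (i + 1) →
    ((1 : Matrix M M ℂ) ⊗ₖ Z i - (P.UB (i + 1)).conjTranspose * P.EB (i + 1) *
      ((1 : Matrix M M ℂ) ⊗ₖ Z (i + 1)) * P.EB (i + 1) * P.UB (i + 1)).PosSemidef
  odd : ∀ i < n, Odd (i + 1) → Z i = Z (i + 1)
  final : Z n = P.povmB 0
  eigenvalue_pos : 0 < α
  eigenvector : (Z 0).mulVec P.ψB = (α : ℂ) • P.ψB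

end Scheme

end WCF

end

/-!
The protocol plays the point game backwards. Alice and Bob hold labels carrying a coordinate, the
message space consists of pairs of labels, and after `i` messages the honest state is
`∑ √p_{N-i}(x, y) |x⟩|x, y⟩|y⟩`.

A line transition `l → r` given by `X ⪯ Y` and `ψ` becomes a message as follows. The normalized
projections of `ψ` onto the eigenspaces of `X` and of `Y` are two orthonormal families. Adding
labels of a large value `D ≥ ‖Y‖` leaves room to dilate them to two orthonormal bases, and the
change of basis `U` takes the amplitudes `√r` to `√l` and satisfies `U† E diag E U ⪯ diag`, where
`diag` is the diagonal matrix of the coordinates and `E` projects onto the labels in the support of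
`l`. Controlled on the label sent by the other party, these `U` and `E` are the messages and the
tests. Hence `diag` is dual feasible, with eigenvalue the coordinate of the initial label, and the
final point `[β, α]` is the initial pair of labels. At the end the points `[0, 1]` and `[1, 0]`
remain: the party holding label `1` has lost, and the projector onto this label is at most `diag`.

Weak duality says that `Tr ((Z_i ⊗ I) ρ_i)` is nonincreasing along primal feasible `ρ_i`. The
reduced states of a cheating strategy are primal feasible, so the dual eigenvalues bound the
cheating probabilities as well.
-/

namespace WCF

/-! ## Partial traces -/

section PartialTrace

open scoped MatrixOrder in
theorem trace_mul_nonneg {𝕜 n : Type*} [RCLike 𝕜] [Fintype n] {X Y : Matrix n n 𝕜}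
    (hX : X.PosSemidef) (hY : Y.PosSemidef) : 0 ≤ (X * Y).trace := by
  classical
  obtain ⟨C, rfl⟩ : ∃ C : Matrix n n 𝕜, Y = C.conjTranspose * C :=
    CStarAlgebra.nonneg_iff_eq_star_mul_self.mp hY.nonneg
  rw [← mul_assoc, Matrix.trace_mul_comm, ← mul_assoc]
  exact (hX.mul_mul_conjTranspose_same C).trace_nonneg

theorem trace_mul_le_trace_mul_of_posSemidef_sub {𝕜 n : Type*} [RCLike 𝕜] [Fintype n]
    {X Y ρ : Matrix n n 𝕜} (hXY : (Y - X).PosSemidef) (hρ : ρ.PosSemidef) :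
    (X * ρ).trace ≤ (Y * ρ).trace := by
  simpa only [sub_mul, Matrix.trace_sub, sub_nonneg] using trace_mul_nonneg hXY hρ

theorem trace_mul_conj {R m n : Type*} [CommSemiring R] [StarRing R] [Fintype m] [Fintype n]
    (X : Matrix m m R) (V : Matrix m n R) (ρ : Matrix n n R) :
    (X * (V * ρ * V.conjTranspose)).trace = (V.conjTranspose * X * V * ρ).trace := by
  rw [← Matrix.mul_assoc, Matrix.trace_mul_comm]
  simp only [Matrix.mul_assoc]

theorem trace_mul_sum_conj_of_commute {R n κ : Type*} [CommSemiring R] [StarRing R] [Fintype n]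
    [DecidableEq n] [Fintype κ] {X : Matrix n n R} {W : κ → Matrix n n R}
    (hXW : ∀ k, Commute X (W k)) (hW : ∑ k, (W k).conjTranspose * W k = 1) (ρ : Matrix n n R) :
    (X * ∑ k, W k * ρ * (W k).conjTranspose).trace = (X * ρ).trace := by
  have hconj k : (W k).conjTranspose * X * W k = (W k).conjTranspose * W k * X := by
    rw [mul_assoc, (hXW k).eq, mul_assoc]
  simp only [Finset.mul_sum, Matrix.trace_sum, trace_mul_conj, hconj]
  rw [← Matrix.trace_sum, ← Finset.sum_mul, ← Finset.sum_mul, hW, one_mul]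

variable {A M B : Type}

theorem posSemidef_traceMRight [Fintype M] {ρ : Matrix (A × M) (A × M) ℂ} (hρ : ρ.PosSemidef) :
    (traceMRight ρ).PosSemidef := by
  have hsum : traceMRight ρ = ∑ m, ρ.submatrix (·, m) (·, m) := by
    ext a a'
    simp only [traceMRight, Matrix.sum_apply, Matrix.submatrix_apply]
  exact hsum ▸ Matrix.posSemidef_sum _ fun m _ => hρ.submatrix _

theorem posSemidef_traceMLeft [Fintype M] {ρ : Matrix (M × B) (M × B) ℂ} (hρ : ρ.PosSemidef) :
    (traceMLeft ρ).PosSemidef :=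
  posSemidef_traceMRight (hρ.submatrix Prod.swap)

theorem traceMRight_kronecker [Fintype M] (X : Matrix A A ℂ) (Y : Matrix M M ℂ) :
    traceMRight (X ⊗ₖ Y) = Y.trace • X := by
  ext a a'
  simp only [traceMRight, Matrix.kroneckerMap_apply, ← Finset.mul_sum, Matrix.smul_apply,
    smul_eq_mul, Matrix.trace, Matrix.diag, mul_comm]

theorem traceMLeft_kronecker [Fintype M] (X : Matrix M M ℂ) (Y : Matrix B B ℂ) :
    traceMLeft (X ⊗ₖ Y) = X.trace • Y := by
  ext b b'
  simp only [traceMLeft, Matrix.kroneckerMap_apply, ← Finset.sum_mul, Matrix.smul_apply,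
    smul_eq_mul, Matrix.trace, Matrix.diag]

variable [Fintype A] [Fintype M] [Fintype B]

theorem trace_mul_traceMRight [DecidableEq M] (Z : Matrix A A ℂ) (ρ : Matrix (A × M) (A × M) ℂ) :
    (Z * traceMRight ρ).trace = ((Z ⊗ₖ (1 : Matrix M M ℂ)) * ρ).trace := by
  simp only [Matrix.trace, Matrix.diag, Matrix.mul_apply, traceMRight, Fintype.sum_prod_type,
    Matrix.kroneckerMap_apply, Matrix.one_apply, mul_ite, mul_one, mul_zero, ite_mul, zero_mul,
    Finset.sum_ite_eq, Finset.mem_univ, if_true, Finset.mul_sum]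
  exact Finset.sum_congr rfl fun a _ => Finset.sum_comm

theorem trace_mul_traceMLeft [DecidableEq M] (Z : Matrix B B ℂ) (ρ : Matrix (M × B) (M × B) ℂ) :
    (Z * traceMLeft ρ).trace = (((1 : Matrix M M ℂ) ⊗ₖ Z) * ρ).trace := by
  simp only [Matrix.trace, Matrix.diag, Matrix.mul_apply, traceMLeft, Fintype.sum_prod_type_right,
    Matrix.kroneckerMap_apply, Matrix.one_apply, one_mul, zero_mul, ite_mul,
    Finset.sum_ite_eq, Finset.mem_univ, if_true, Finset.mul_sum]
  exact Finset.sum_congr rfl fun b _ => Finset.sum_comm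

theorem traceMRight_conj_kronecker_one [DecidableEq M] (V : Matrix A A ℂ)
    (ρ : Matrix (A × M) (A × M) ℂ) :
    traceMRight ((V ⊗ₖ (1 : Matrix M M ℂ)) * ρ * (V ⊗ₖ (1 : Matrix M M ℂ)).conjTranspose) =
      V * traceMRight ρ * V.conjTranspose := by
  refine Matrix.ext_iff_trace_mul_left.mpr fun Z => ?_
  rw [trace_mul_traceMRight, trace_mul_conj, trace_mul_conj, trace_mul_traceMRight,
    Matrix.conjTranspose_kronecker, Matrix.conjTranspose_one, ← Matrix.mul_kronecker_mul,
    ← Matrix.mul_kronecker_mul, mul_one, mul_one]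

theorem traceMLeft_conj_one_kronecker [DecidableEq M] (V : Matrix B B ℂ)
    (ρ : Matrix (M × B) (M × B) ℂ) :
    traceMLeft (((1 : Matrix M M ℂ) ⊗ₖ V) * ρ * ((1 : Matrix M M ℂ) ⊗ₖ V).conjTranspose) =
      V * traceMLeft ρ * V.conjTranspose := by
  refine Matrix.ext_iff_trace_mul_left.mpr fun Z => ?_
  rw [trace_mul_traceMLeft, trace_mul_conj, trace_mul_conj, trace_mul_traceMLeft,
    Matrix.conjTranspose_kronecker, Matrix.conjTranspose_one, ← Matrix.mul_kronecker_mul,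
    ← Matrix.mul_kronecker_mul, mul_one, mul_one]

variable {κ : Type*} [Fintype κ] {K : κ → Matrix M M ℂ} [DecidableEq M]

theorem traceMRight_sum_conj_one_kronecker [DecidableEq A]
    (hK : ∑ k, (K k).conjTranspose * K k = 1) (ρ : Matrix (A × M) (A × M) ℂ) :
    traceMRight (∑ k, ((1 : Matrix A A ℂ) ⊗ₖ K k) * ρ * ((1 : Matrix A A ℂ) ⊗ₖ K k).conjTranspose) =
      traceMRight ρ := by
  refine Matrix.ext_iff_trace_mul_left.mpr fun Z => ?_
  rw [trace_mul_traceMRight, trace_mul_traceMRight]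
  refine trace_mul_sum_conj_of_commute (fun k => ?_) ?_ ρ
  · simp only [Commute, SemiconjBy, ← Matrix.mul_kronecker_mul, mul_one, one_mul]
  · simp only [Matrix.conjTranspose_kronecker, Matrix.conjTranspose_one,
      ← Matrix.mul_kronecker_mul, mul_one]
    rw [← Matrix.one_kronecker_one, ← hK]
    exact (map_sum (Matrix.kroneckerBilinear (R := ℂ) (1 : Matrix A A ℂ)) _ _).symm

theorem traceMLeft_sum_conj_kronecker_one [DecidableEq B]
    (hK : ∑ k, (K k).conjTranspose * K k = 1) (ρ : Matrix (M × B) (M × B) ℂ) :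
    traceMLeft (∑ k, (K k ⊗ₖ (1 : Matrix B B ℂ)) * ρ * (K k ⊗ₖ (1 : Matrix B B ℂ)).conjTranspose) =
      traceMLeft ρ := by
  refine Matrix.ext_iff_trace_mul_left.mpr fun Z => ?_
  rw [trace_mul_traceMLeft, trace_mul_traceMLeft]
  refine trace_mul_sum_conj_of_commute (fun k => ?_) ?_ ρ
  · simp only [Commute, SemiconjBy, ← Matrix.mul_kronecker_mul, mul_one, one_mul]
  · simp only [Matrix.conjTranspose_kronecker, Matrix.conjTranspose_one,
      ← Matrix.mul_kronecker_mul, mul_one]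
    rw [← Matrix.one_kronecker_one, ← hK]
    exact (map_sum ((Matrix.kroneckerBilinear (R := ℂ) (α := ℂ)).flip (1 : Matrix B B ℂ)) _ _).symm

end PartialTrace

/-! ## Weak duality -/

section Reduced

variable {A M B : Type}

/-- The state of `𝒜 ⊗ ℳ` obtained from a state of `𝒜 ⊗ ℳ ⊗ ℬ` by tracing out `ℬ`. -/
def reducedAM [Fintype B] (ρ : Matrix (A × M × B) (A × M × B) ℂ) : Matrix (A × M) (A × M) ℂ :=
  traceMRight (ρ.submatrix (Equiv.prodAssoc A M B) (Equiv.prodAssoc A M B))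

/-- The state of `ℳ ⊗ ℬ` obtained from a state of `𝒜 ⊗ ℳ ⊗ ℬ` by tracing out `𝒜`. -/
def reducedMB [Fintype A] (ρ : Matrix (A × M × B) (A × M × B) ℂ) : Matrix (M × B) (M × B) ℂ :=
  traceMLeft ρ

theorem traceMRight_reducedAM [Fintype M] [Fintype B] (ρ : Matrix (A × M × B) (A × M × B) ℂ) :
    traceMRight (reducedAM ρ) = traceMRight ρ := by
  ext a a'
  simp only [traceMRight, reducedAM, Fintype.sum_prod_type, Matrix.submatrix_apply,
    Equiv.prodAssoc_apply]

theorem traceMLeft_reducedMB [Fintype A] [Fintype M] (ρ : Matrix (A × M × B) (A × M × B) ℂ) :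
    traceMLeft (reducedMB ρ) =
      traceMLeft (ρ.submatrix (Equiv.prodAssoc A M B) (Equiv.prodAssoc A M B)) := by
  ext b b'
  simp only [traceMLeft, reducedMB, Fintype.sum_prod_type_right, Matrix.submatrix_apply,
    Equiv.prodAssoc_apply]

variable [Fintype A] [Fintype M] [Fintype B]

theorem submatrix_prodAssoc_conj_liftAM [DecidableEq B] (V : Matrix (A × M) (A × M) ℂ)
    (ρ : Matrix (A × M × B) (A × M × B) ℂ) :
    (liftAM V * ρ * (liftAM V).conjTranspose).submatrix (Equiv.prodAssoc A M B)
        (Equiv.prodAssoc A M B) =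
      (V ⊗ₖ (1 : Matrix B B ℂ)) * ρ.submatrix (Equiv.prodAssoc A M B) (Equiv.prodAssoc A M B) *
        (V ⊗ₖ (1 : Matrix B B ℂ)).conjTranspose := by
  rw [← Matrix.submatrix_mul_equiv (e₂ := Equiv.prodAssoc A M B),
    ← Matrix.submatrix_mul_equiv (e₂ := Equiv.prodAssoc A M B)]
  rfl

theorem reducedAM_conj_liftAM [DecidableEq B] (V : Matrix (A × M) (A × M) ℂ)
    (ρ : Matrix (A × M × B) (A × M × B) ℂ) :
    reducedAM (liftAM V * ρ * (liftAM V).conjTranspose) = V * reducedAM ρ * V.conjTranspose := by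
  rw [reducedAM, submatrix_prodAssoc_conj_liftAM, traceMRight_conj_kronecker_one, reducedAM]

theorem reducedMB_conj_liftMB [DecidableEq A] (V : Matrix (M × B) (M × B) ℂ)
    (ρ : Matrix (A × M × B) (A × M × B) ℂ) :
    reducedMB (liftMB V * ρ * (liftMB V).conjTranspose) = V * reducedMB ρ * V.conjTranspose :=
  traceMLeft_conj_one_kronecker V ρ

variable {κ : Type*} [Fintype κ] [DecidableEq M]

theorem traceMRight_reducedAM_sum_conj_liftMB [DecidableEq A] [DecidableEq B]
    {K : κ → Matrix (M × B) (M × B) ℂ} (hK : ∑ k, (K k).conjTranspose * K k = 1)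
    (ρ : Matrix (A × M × B) (A × M × B) ℂ) :
    traceMRight (reducedAM (∑ k, liftMB (K k) * ρ * (liftMB (K k)).conjTranspose)) =
      traceMRight (reducedAM ρ) := by
  rw [traceMRight_reducedAM, traceMRight_reducedAM]
  exact traceMRight_sum_conj_one_kronecker hK ρ

theorem traceMLeft_reducedMB_sum_conj_liftAM [DecidableEq A] [DecidableEq B]
    {K : κ → Matrix (A × M) (A × M) ℂ} (hK : ∑ k, (K k).conjTranspose * K k = 1)
    (ρ : Matrix (A × M × B) (A × M × B) ℂ) :
    traceMLeft (reducedMB (∑ k, liftAM (K k) * ρ * (liftAM (K k)).conjTranspose)) =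
      traceMLeft (reducedMB ρ) := by
  have hsum : (∑ k, liftAM (K k) * ρ * (liftAM (K k)).conjTranspose).submatrix
      (Equiv.prodAssoc A M B) (Equiv.prodAssoc A M B) =
      ∑ k, (K k ⊗ₖ (1 : Matrix B B ℂ)) *
        ρ.submatrix (Equiv.prodAssoc A M B) (Equiv.prodAssoc A M B) *
        (K k ⊗ₖ (1 : Matrix B B ℂ)).conjTranspose := by
    simp only [← submatrix_prodAssoc_conj_liftAM]
    ext i j
    simp only [Matrix.submatrix_apply, Matrix.sum_apply]
  rw [traceMLeft_reducedMB, traceMLeft_reducedMB, hsum, traceMLeft_sum_conj_kronecker_one hK]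

end Reduced

section Ketbra

variable {A : Type}

theorem posSemidef_ketbra [Finite A] (v : A → ℂ) : (ketbra v).PosSemidef :=
  have := Fintype.ofFinite A
  Matrix.posSemidef_vecMulVec_self_star v

variable [Fintype A]

theorem trace_ketbra (v : A → ℂ) : (ketbra v).trace = (normSq v : ℂ) := by
  simp only [ketbra, Matrix.trace_vecMulVec, normSq, dotProduct, Pi.star_apply, Complex.star_def,
    Complex.mul_conj', Complex.ofReal_sum, Complex.ofReal_pow]

theorem trace_mul_ketbra_of_eigenvector {Z : Matrix A A ℂ} {v : A → ℂ} {c : ℂ}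
    (hZv : Z.mulVec v = c • v) (hv : normSq v = 1) : (Z * ketbra v).trace = c := by
  rw [ketbra, Matrix.mul_vecMulVec, hZv, Matrix.smul_vecMulVec, ← ketbra, Matrix.trace_smul,
    trace_ketbra, hv, Complex.ofReal_one, smul_eq_mul, mul_one]

end Ketbra

namespace Scheme

section CheatingStates

variable {A M B : Type} [Fintype M] [DecidableEq M]

theorem posSemidef_stateVsBob [Fintype A] [DecidableEq A] (P : Scheme A M B)
    (s : BobStrategy M) (i : ℕ) :
    (P.stateVsBob s i).PosSemidef := by
  induction i with
  | zero => exact (posSemidef_ketbra _).kronecker ((posSemidef_ketbra _).kronecker s.σ_pos)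
  | succ i ih =>
    rw [stateVsBob]
    split_ifs
    · exact ih.mul_mul_conjTranspose_same _
    · exact Matrix.posSemidef_sum _ fun k _ => ih.mul_mul_conjTranspose_same _

theorem posSemidef_stateVsAlice [Fintype B] [DecidableEq B] (P : Scheme A M B)
    (s : AliceStrategy M) (i : ℕ) :
    (P.stateVsAlice s i).PosSemidef := by
  induction i with
  | zero => exact (s.σ_pos.kronecker (posSemidef_ketbra _)).submatrix _
  | succ i ih =>
    rw [stateVsAlice]
    split_ifs
    · exact Matrix.posSemidef_sum _ fun k _ => ih.mul_mul_conjTranspose_same _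
    · exact ih.mul_mul_conjTranspose_same _

end CheatingStates

variable {A M B : Type} [Fintype A] [Fintype M] [Fintype B]
  [DecidableEq A] [DecidableEq M] [DecidableEq B] {P : Scheme A M B} {n : ℕ}

theorem IsProtocol.conjTranspose_EA (hP : P.IsProtocol n) {i : ℕ} (hi : i < n) (ho : Odd (i + 1)) :
    (P.EA (i + 1)).conjTranspose = P.EA (i + 1) :=
  (hP.EA_proj (i + 1) (Nat.le_add_left 1 i) hi ho).isSelfAdjoint.star_eq

theorem IsProtocol.conjTranspose_EB (hP : P.IsProtocol n) {i : ℕ} (hi : i < n)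
    (he : Even (i + 1)) : (P.EB (i + 1)).conjTranspose = P.EB (i + 1) :=
  (hP.EB_proj (i + 1) (Nat.le_add_left 1 i) hi he).isSelfAdjoint.star_eq

theorem IsProtocol.primalB_reducedAM_stateVsBob (hP : P.IsProtocol n) (s : BobStrategy M) :
    P.PrimalB n fun i => reducedAM (P.stateVsBob s i) where
  pos i _ := posSemidef_traceMRight ((P.posSemidef_stateVsBob s i).submatrix _)
  init := by
    rw [traceMRight_reducedAM, stateVsBob, traceMRight_kronecker, Matrix.trace_kronecker,
      trace_ketbra, hP.ψM_unit, s.σ_trace, Complex.ofReal_one, one_mul, one_smul]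
  odd i hi ho := by
    rw [stateVsBob, if_pos ho, reducedAM_conj_liftAM, Matrix.conjTranspose_mul,
      hP.conjTranspose_EA hi ho, ← mul_assoc]
  even i _ he := by
    rw [stateVsBob, if_neg (Nat.not_odd_iff_even.mpr he)]
    exact traceMRight_reducedAM_sum_conj_liftMB (s.K_tp (i + 1)) _

theorem IsProtocol.primalA_reducedMB_stateVsAlice (hP : P.IsProtocol n) (s : AliceStrategy M) :
    P.PrimalA n fun i => reducedMB (P.stateVsAlice s i) where
  pos i _ := posSemidef_traceMLeft (P.posSemidef_stateVsAlice s i)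
  init := by
    have hinit : (P.stateVsAlice s 0).submatrix (Equiv.prodAssoc _ M B) (Equiv.prodAssoc _ M B) =
        s.σ ⊗ₖ ketbra P.ψB := rfl
    rw [traceMLeft_reducedMB, hinit, traceMLeft_kronecker, s.σ_trace, one_smul]
  even i hi he := by
    rw [stateVsAlice, if_neg (Nat.not_odd_iff_even.mpr he), reducedMB_conj_liftMB,
      Matrix.conjTranspose_mul, hP.conjTranspose_EB hi he, ← mul_assoc]
  odd i _ ho := by
    rw [stateVsAlice, if_pos ho]
    exact traceMLeft_reducedMB_sum_conj_liftAM (s.K_tp (i + 1)) _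

theorem IsProtocol.cheatB_le_primalValueB (hP : P.IsProtocol n) :
    P.cheatB n ≤ P.primalValueB n := by
  refine iSup_le fun s => le_iSup₂_of_le _ (hP.primalB_reducedAM_stateVsBob s) (le_of_eq ?_)
  rw [← trace_mul_traceMRight, ← trace_mul_traceMRight, traceMRight_reducedAM]

theorem IsProtocol.cheatA_le_primalValueA (hP : P.IsProtocol n) :
    P.cheatA n ≤ P.primalValueA n := by
  refine iSup_le fun s => le_iSup₂_of_le _ (hP.primalA_reducedMB_stateVsAlice s) (le_of_eq ?_)
  exact congrArg (fun z : ℂ => (z.re : EReal)) (trace_mul_traceMLeft _ (P.stateVsAlice s n)).symm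

theorem PrimalB.trace_mul_succ_le (hP : P.IsProtocol n) {ρ : ℕ → Matrix (A × M) (A × M) ℂ}
    (hρ : P.PrimalB n ρ) {Z : ℕ → Matrix A A ℂ} {β : ℝ} (hZ : P.DualFeasibleA n Z β) {i : ℕ}
    (hi : i < n) :
    (Z (i + 1) * traceMRight (ρ (i + 1))).trace ≤ (Z i * traceMRight (ρ i)).trace := by
  rcases Nat.even_or_odd (i + 1) with he | ho
  · rw [hρ.even i hi he, hZ.even i hi he]
  · have hconj := trace_mul_conj (Z (i + 1) ⊗ₖ (1 : Matrix M M ℂ))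
      (P.EA (i + 1) * P.UA (i + 1)) (ρ i)
    rw [Matrix.conjTranspose_mul, hP.conjTranspose_EA hi ho] at hconj
    rw [hρ.odd i hi ho, trace_mul_traceMRight, trace_mul_traceMRight]
    simp only [← mul_assoc] at hconj ⊢
    exact hconj.le.trans <| trace_mul_le_trace_mul_of_posSemidef_sub (hZ.odd i hi ho)
      (hρ.pos i hi.le)

theorem PrimalA.trace_mul_succ_le (hP : P.IsProtocol n) {ρ : ℕ → Matrix (M × B) (M × B) ℂ}
    (hρ : P.PrimalA n ρ) {Z : ℕ → Matrix B B ℂ} {α : ℝ} (hZ : P.DualFeasibleB n Z α) {i : ℕ}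
    (hi : i < n) :
    (Z (i + 1) * traceMLeft (ρ (i + 1))).trace ≤ (Z i * traceMLeft (ρ i)).trace := by
  rcases Nat.even_or_odd (i + 1) with he | ho
  · have hconj := trace_mul_conj ((1 : Matrix M M ℂ) ⊗ₖ Z (i + 1))
      (P.EB (i + 1) * P.UB (i + 1)) (ρ i)
    rw [Matrix.conjTranspose_mul, hP.conjTranspose_EB hi he] at hconj
    rw [hρ.even i hi he, trace_mul_traceMLeft, trace_mul_traceMLeft]
    simp only [← mul_assoc] at hconj ⊢
    exact hconj.le.trans <| trace_mul_le_trace_mul_of_posSemidef_sub (hZ.even i hi he)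
      (hρ.pos i hi.le)
  · rw [hρ.odd i hi ho, hZ.odd i hi ho]

theorem IsProtocol.primalValueB_le (hP : P.IsProtocol n) {Z : ℕ → Matrix A A ℂ} {β : ℝ}
    (hZ : P.DualFeasibleA n Z β) : P.primalValueB n ≤ (β : EReal) := by
  refine iSup₂_le fun ρ hρ => EReal.coe_le_coe_iff.mpr ?_
  have hanti : AntitoneOn (fun i => (Z i * traceMRight (ρ i)).trace) (Set.Iic n) :=
    antitoneOn_of_succ_le Set.ordConnected_Iic fun i _ _ hi => hρ.trace_mul_succ_le hP hZ hi
  have hle := hanti (Set.mem_Iic.mpr n.zero_le) (Set.mem_Iic.mpr le_rfl) n.zero_le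
  beta_reduce at hle
  rw [hρ.init, trace_mul_ketbra_of_eigenvector hZ.eigenvector hP.ψA_unit, hZ.final,
    trace_mul_traceMRight] at hle
  exact (Complex.le_def.mp hle).1

theorem IsProtocol.primalValueA_le (hP : P.IsProtocol n) {Z : ℕ → Matrix B B ℂ} {α : ℝ}
    (hZ : P.DualFeasibleB n Z α) : P.primalValueA n ≤ (α : EReal) := by
  refine iSup₂_le fun ρ hρ => EReal.coe_le_coe_iff.mpr ?_
  have hanti : AntitoneOn (fun i => (Z i * traceMLeft (ρ i)).trace) (Set.Iic n) :=
    antitoneOn_of_succ_le Set.ordConnected_Iic fun i _ _ hi => hρ.trace_mul_succ_le hP hZ hi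
  have hle := hanti (Set.mem_Iic.mpr n.zero_le) (Set.mem_Iic.mpr le_rfl) n.zero_le
  beta_reduce at hle
  rw [hρ.init, trace_mul_ketbra_of_eigenvector hZ.eigenvector hP.ψB_unit, hZ.final,
    trace_mul_traceMLeft] at hle
  exact (Complex.le_def.mp hle).1

end Scheme

/-! ## Spectral decomposition of a vector -/

section Eigenframe

variable {𝕜 E ι : Type*} [RCLike 𝕜] [NormedAddCommGroup E] [InnerProductSpace 𝕜 E]

/-- `f` consists of pairwise orthogonal eigenvectors of `S` with eigenvalues `μ`, each of them a
unit vector or zero. Zero is allowed so that the eigenvectors of two operators in the spectral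
decompositions of one vector can be indexed by the same points. -/
structure IsEigenframe (S : E →ₗ[𝕜] E) (μ : ι → ℝ) (f : ι → E) : Prop where
  apply_eq : ∀ i, S (f i) = (μ i : 𝕜) • f i
  orthogonal : Pairwise fun i j => inner 𝕜 (f i) (f j) = 0
  eq_zero_or_norm : ∀ i, f i = 0 ∨ ‖f i‖ = 1

namespace IsEigenframe

variable {S : E →ₗ[𝕜] E} {μ : ι → ℝ} {f : ι → E} [Fintype ι]

theorem inner_sum_smul (hf : IsEigenframe S μ f) (c : ι → 𝕜) (i : ι) :
    inner 𝕜 (f i) (∑ j, c j • f j) = c i * (‖f i‖ : 𝕜) ^ 2 := by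
  rw [inner_sum, Finset.sum_eq_single i, inner_smul_right, inner_self_eq_norm_sq_to_K]
  · intro j _ hj
    rw [inner_smul_right, hf.orthogonal hj.symm, mul_zero]
  · exact fun hi => absurd (Finset.mem_univ i) hi

theorem inner_sub_sum_eq_zero (hf : IsEigenframe S μ f) (u : E) (i : ι) :
    inner 𝕜 (f i) (u - ∑ j, inner 𝕜 (f j) u • f j) = 0 := by
  rw [inner_sub_right, hf.inner_sum_smul]
  rcases hf.eq_zero_or_norm i with hzero | hunit
  · simp only [hzero, inner_zero_left, zero_mul, sub_zero]
  · simp only [hunit, RCLike.ofReal_one, one_pow, mul_one, sub_self]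

theorem re_inner_sum_add (hf : IsEigenframe S μ f) (hS : S.IsSymmetric) (c : ι → 𝕜) {t : E}
    (ht : ∀ i, inner 𝕜 (f i) t = 0) :
    RCLike.re (inner 𝕜 (∑ i, c i • f i + t) (S (∑ i, c i • f i + t))) =
      ∑ i, μ i * (‖c i‖ ^ 2 * ‖f i‖ ^ 2) + RCLike.re (inner 𝕜 t (S t)) := by
  have hSsum : S (∑ i, c i • f i) = ∑ i, (c i * μ i) • f i := by
    simp only [map_sum, map_smul, hf.apply_eq, smul_smul]
  have horth (a : ι → 𝕜) : inner 𝕜 t (∑ i, a i • f i) = 0 := by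
    simp only [inner_sum, inner_smul_right, inner_eq_zero_symm.mp (ht _), mul_zero,
      Finset.sum_const_zero]
  have hdiag : inner 𝕜 (∑ i, c i • f i) (∑ i, (c i * μ i) • f i) =
      ((∑ i, μ i * (‖c i‖ ^ 2 * ‖f i‖ ^ 2) : ℝ) : 𝕜) := by
    simp only [sum_inner, inner_smul_left, hf.inner_sum_smul, RCLike.ofReal_sum]
    refine Finset.sum_congr rfl fun i _ => ?_
    push_cast
    rw [← RCLike.conj_mul]
    ring
  rw [map_add, hSsum, inner_add_left, inner_add_right, inner_add_right, horth, ← hS, hSsum,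
    inner_eq_zero_symm.mp (horth _), hdiag, add_zero, zero_add, map_add, RCLike.ofReal_re]

theorem sum_eigenvalue_mul_le_re_inner (hf : IsEigenframe S μ f) (hS : S.IsPositive) (u : E) :
    ∑ i, μ i * ‖inner 𝕜 (f i) u‖ ^ 2 ≤ RCLike.re (inner 𝕜 u (S u)) := by
  have hsplit := hf.re_inner_sum_add hS.isSymmetric (fun i => inner 𝕜 (f i) u)
    (hf.inner_sub_sum_eq_zero u)
  rw [add_sub_cancel] at hsplit
  rw [hsplit]
  refine le_add_of_le_of_nonneg (Finset.sum_le_sum fun i _ => le_of_eq ?_)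
    (hS.re_inner_nonneg_right _)
  rcases hf.eq_zero_or_norm i with hzero | hunit
  · simp only [hzero, inner_zero_left, norm_zero, ne_eq, OfNat.ofNat_ne_zero, not_false_eq_true,
      zero_pow, mul_zero]
  · rw [hunit, one_pow, mul_one]

theorem re_inner_le_sum_eigenvalue_mul_add [FiniteDimensional 𝕜 E] (hf : IsEigenframe S μ f)
    (hS : S.IsSymmetric) (hμ : ∀ i, 0 ≤ μ i) (c : ι → 𝕜) {t : E}
    (ht : ∀ i, inner 𝕜 (f i) t = 0) :
    RCLike.re (inner 𝕜 (∑ i, c i • f i + t) (S (∑ i, c i • f i + t))) ≤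
      ∑ i, μ i * ‖c i‖ ^ 2 + ‖LinearMap.toContinuousLinearMap S‖ * ‖t‖ ^ 2 := by
  rw [hf.re_inner_sum_add hS c ht]
  refine add_le_add (Finset.sum_le_sum fun i _ => mul_le_mul_of_nonneg_left ?_ (hμ i)) ?_
  · refine mul_le_of_le_one_right (sq_nonneg _) (pow_le_one₀ (norm_nonneg _) ?_)
    rcases hf.eq_zero_or_norm i with hzero | hunit
    · simp only [hzero, norm_zero, zero_le_one]
    · exact hunit.le
  · calc RCLike.re (inner 𝕜 t (S t)) ≤ ‖t‖ * ‖S t‖ := re_inner_le_norm t (S t)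
      _ ≤ ‖t‖ * (‖LinearMap.toContinuousLinearMap S‖ * ‖t‖) := by
        gcongr
        exact (LinearMap.toContinuousLinearMap S).le_opNorm t
      _ = ‖LinearMap.toContinuousLinearMap S‖ * ‖t‖ ^ 2 := by ring

end IsEigenframe

variable {F : Type*} [NormedAddCommGroup F] [InnerProductSpace 𝕜 F] [FiniteDimensional 𝕜 E]
  [FiniteDimensional 𝕜 F]

theorem IsEigenframe.exists_orthonormal_dilation {S : E →ₗ[𝕜] E} {μ : ι → ℝ} {f : ι → E}
    (hf : IsEigenframe S μ f) (κ : E →ₗᵢ[𝕜] F) {u : ι → F} (hu : Orthonormal 𝕜 u)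
    (hκ : ∀ i x, inner 𝕜 (u i) (κ x) = 0) :
    ∃ v : ι → F, Orthonormal 𝕜 v ∧ (∀ i, f i ≠ 0 → v i = κ (f i)) ∧
      ∀ i, LinearMap.adjoint κ.toLinearMap (v i) = f i := by
  classical
  refine ⟨fun i => if f i = 0 then u i else κ (f i), ⟨fun i => ?_, fun i j hij => ?_⟩,
    fun i hi => if_neg hi, fun i => ext_inner_left 𝕜 fun x => ?_⟩
  · dsimp only
    split_ifs with hi
    · exact hu.1 i
    · rw [κ.norm_map, (hf.eq_zero_or_norm i).resolve_left hi]
  · dsimp only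
    split_ifs
    · exact hu.2 hij
    · exact hκ i _
    · exact inner_eq_zero_symm.mp (hκ j _)
    · rw [κ.inner_map_map, hf.orthogonal hij]
  · rw [LinearMap.adjoint_inner_right]
    dsimp only
    split_ifs with hi
    · rw [hi, inner_zero_right]
      exact inner_eq_zero_symm.mp (hκ i x)
    · exact κ.inner_map_map x (f i)

end Eigenframe

section Prob

open Module.End

section SpectralDecomposition

variable {E : Type*} [NormedAddCommGroup E] [InnerProductSpace ℂ E] {S : E →ₗ[ℂ] E}

theorem exists_nnreal_eq_of_hasEigenvalue (hS : S.IsPositive) {c : ℂ} (hc : HasEigenvalue S c) :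
    ∃ z : ℝ≥0, ((z : ℝ) : ℂ) = c := by
  obtain ⟨x, rfl⟩ := Complex.conj_eq_iff_real.mp (hS.isSymmetric.conj_eigenvalue_eq_self hc)
  exact ⟨⟨x, eigenvalue_nonneg_of_nonneg hc fun v => hS.re_inner_nonneg_right v⟩, rfl⟩

theorem orthogonalFamily_eigenspaces_nnreal (hS : S.IsSymmetric) :
    OrthogonalFamily ℂ (fun z : ℝ≥0 => eigenspace S ((z : ℝ) : ℂ))
      fun z => (eigenspace S ((z : ℝ) : ℂ)).subtypeₗᵢ :=
  hS.orthogonalFamily_eigenspaces.comp (γ := ℝ≥0) (f := fun z => ((z : ℝ) : ℂ))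
    (Complex.ofReal_injective.comp NNReal.coe_injective)

variable [FiniteDimensional ℂ E]

theorem sum_starProjection_eigenspace_eq (hS : S.IsPositive) {T : Finset ℝ≥0} {v : E}
    (hT : ∀ z ∉ T, (eigenspace S ((z : ℝ) : ℂ)).starProjection v = 0) :
    ∑ z ∈ T, (eigenspace S ((z : ℝ) : ℂ)).starProjection v = v := by
  classical
  set g : ℝ≥0 → E := fun z => (eigenspace S ((z : ℝ) : ℂ)).starProjection v
  have hcross (x z : ℝ≥0) :
      (eigenspace S ((x : ℝ) : ℂ)).starProjection (g z) = if z = x then g x else 0 := by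
    split_ifs with hzx
    · rw [hzx]
      exact Submodule.starProjection_eq_self_iff.mpr (Submodule.starProjection_apply_mem _ _)
    · refine (Submodule.starProjection_apply_eq_zero_iff _).mpr fun w hw => ?_
      exact orthogonalFamily_eigenspaces_nnreal hS.isSymmetric (Ne.symm hzx) ⟨w, hw⟩
        ⟨g z, Submodule.starProjection_apply_mem _ _⟩
  suffices hmem : v - ∑ z ∈ T, g z ∈ (⨆ c, eigenspace S c)ᗮ by
    rw [hS.isSymmetric.orthogonalComplement_iSup_eigenspaces_eq_bot, Submodule.mem_bot,
      sub_eq_zero] at hmem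
    exact hmem.symm
  rw [← Submodule.iInf_orthogonal, Submodule.mem_iInf]
  intro c
  by_cases hc : HasEigenvalue S c
  · obtain ⟨x, rfl⟩ := exists_nnreal_eq_of_hasEigenvalue hS hc
    rw [← Submodule.starProjection_apply_eq_zero_iff, map_sub, map_sum, sub_eq_zero]
    simp only [hcross, Finset.sum_ite_eq']
    split_ifs with hx
    · rfl
    · exact hT x hx
  · rw [not_not.mp (mt hasEigenvalue_iff.mpr hc), Submodule.bot_orthogonal_eq_top]
    exact Submodule.mem_top

end SpectralDecomposition

variable {d : ℕ}

theorem prob_eq_norm_sq (Z : Matrix (Fin d) (Fin d) ℂ) (ψ : EuclideanSpace ℂ (Fin d)) (z : ℝ≥0) :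
    prob Z ψ z = ‖(eigenspace Z.toEuclideanLin ((z : ℝ) : ℂ)).starProjection ψ‖ ^ 2 := by
  rw [prob, ← inner_conj_symm, Complex.conj_re]
  exact Submodule.re_inner_starProjection_eq_normSq
    (eigenspace Z.toEuclideanLin ((z : ℝ) : ℂ)) ψ

theorem exists_isEigenframe_of_prob {Z : Matrix (Fin d) (Fin d) ℂ} (hZ : Z.PosSemidef)
    {ψ : EuclideanSpace ℂ (Fin d)} {l : ℝ≥0 → ℝ≥0} (hl : ∀ z, (l z : ℝ) = prob Z ψ z)
    {T : Finset ℝ≥0} (hT : ∀ z, l z ≠ 0 → z ∈ T) :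
    ∃ e : T → EuclideanSpace ℂ (Fin d),
      IsEigenframe Z.toEuclideanLin (fun x : T => ((x : ℝ≥0) : ℝ)) e ∧
        (∀ x : T, l x ≠ 0 → e x ≠ 0) ∧ ∑ x : T, ((√(l x : ℝ) : ℝ) : ℂ) • e x = ψ := by
  have hpos : Z.toEuclideanLin.IsPositive := Matrix.isPositive_toEuclideanLin_iff.mpr hZ
  set g : ℝ≥0 → EuclideanSpace ℂ (Fin d) := fun z =>
    (eigenspace Z.toEuclideanLin ((z : ℝ) : ℂ)).starProjection ψ
  have hg_mem (z : ℝ≥0) : g z ∈ eigenspace Z.toEuclideanLin ((z : ℝ) : ℂ) :=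
    Submodule.starProjection_apply_mem _ _
  have hnorm (z : ℝ≥0) : √(l z : ℝ) = ‖g z‖ := by
    rw [hl, prob_eq_norm_sq, Real.sqrt_sq (norm_nonneg _)]
  have hzero {z : ℝ≥0} (hz : l z = 0) : g z = 0 := by
    rw [← norm_eq_zero, ← hnorm, hz, NNReal.coe_zero, Real.sqrt_zero]
  refine ⟨fun x => (‖g x‖ : ℂ)⁻¹ • g x, ⟨fun x => ?_, fun x y hxy => ?_, fun x => ?_⟩,
    fun x hx => ?_, ?_⟩
  · rw [map_smul, mem_eigenspace_iff.mp (hg_mem x), smul_comm]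
    rfl
  · have horth : inner ℂ (g x) (g y) = 0 :=
      orthogonalFamily_eigenspaces_nnreal hpos.isSymmetric (Subtype.coe_injective.ne hxy)
        ⟨g x, hg_mem x⟩ ⟨g y, hg_mem y⟩
    dsimp only
    rw [inner_smul_left, inner_smul_right, horth, mul_zero, mul_zero]
  · exact (eq_or_ne (g x) 0).imp (fun h => by rw [h, smul_zero]) norm_smul_inv_norm
  · have hgx : g x ≠ 0 := by
      rwa [← norm_ne_zero_iff, ← hnorm, Real.sqrt_ne_zero', NNReal.coe_pos, pos_iff_ne_zero]
    exact smul_ne_zero (inv_ne_zero (Complex.ofReal_ne_zero.mpr (norm_ne_zero_iff.mpr hgx))) hgx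
  · calc ∑ x : T, ((√(l x : ℝ) : ℝ) : ℂ) • (‖g x‖ : ℂ)⁻¹ • g x = ∑ x : T, g x := by
          refine Finset.sum_congr rfl fun x _ => ?_
          rcases eq_or_ne (g x) 0 with hgx | hgx
          · rw [hgx, smul_zero, smul_zero]
          · rw [hnorm, smul_inv_smul₀ (Complex.ofReal_ne_zero.mpr (norm_ne_zero_iff.mpr hgx))]
      _ = ∑ z ∈ T, g z := Finset.sum_coe_sort T g
      _ = ψ := sum_starProjection_eigenspace_eq hpos fun z hz =>
          hzero (not_not.mp (mt (hT z) hz))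

end Prob

/-! ## Line transitions as changes of basis -/

section Dilation

variable {𝕜 E F ι : Type*} [RCLike 𝕜] [NormedAddCommGroup E] [InnerProductSpace 𝕜 E]
  [NormedAddCommGroup F] [InnerProductSpace 𝕜 F] [Fintype ι]

theorem linearIsometry_map_sum_smul {κ : E →ₗᵢ[𝕜] F} {f : ι → E} {b : ι → F}
    (hb : ∀ i, f i ≠ 0 → b i = κ (f i)) {c : ι → 𝕜} (hc : ∀ i, c i ≠ 0 → f i ≠ 0) :
    κ (∑ i, c i • f i) = ∑ i, c i • b i := by
  rw [map_sum]
  refine Finset.sum_congr rfl fun i _ => ?_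
  rcases eq_or_ne (c i) 0 with hi | hi
  · rw [hi, zero_smul, zero_smul, map_zero]
  · rw [map_smul, hb i (hc i hi)]

theorem sum_smul_inl_eq_repr_symm {τ : Type*} [Fintype τ] (b : OrthonormalBasis (ι ⊕ τ) 𝕜 E)
    (c : ι → 𝕜) : ∑ i, c i • b (Sum.inl i) = b.repr.symm (WithLp.toLp 2 (Sum.elim c 0)) := by
  rw [← b.sum_repr_symm, Fintype.sum_sum_type]
  simp only [Sum.elim_inl, Sum.elim_inr, Pi.zero_apply, zero_smul, Finset.sum_const_zero, add_zero]

theorem toMatrix_mulVec_apply_eq_inner (b b' : OrthonormalBasis ι 𝕜 E) (w : ι → 𝕜) (i : ι) :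
    (b.toBasis.toMatrix b').mulVec w i = inner 𝕜 (b i) (b'.repr.symm (WithLp.toLp 2 w)) := by
  classical
  rw [← b'.sum_repr_symm, inner_sum, Matrix.mulVec, dotProduct]
  refine Finset.sum_congr rfl fun j _ => ?_
  rw [Module.Basis.toMatrix_apply, b.coe_toBasis_repr_apply, b.repr_apply_apply, inner_smul_right,
    mul_comm]

theorem exists_orthonormalBasis_inl_eq [FiniteDimensional 𝕜 E] {τ : Type*} [Fintype τ] {v : ι → E}
    (hv : Orthonormal 𝕜 v) (hE : Module.finrank 𝕜 E = Fintype.card (ι ⊕ τ)) :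
    ∃ b : OrthonormalBasis (ι ⊕ τ) 𝕜 E, ∀ i, b (Sum.inl i) = v i := by
  have hrange : Orthonormal 𝕜 ((Set.range Sum.inl).domRestrict (Sum.elim v (0 : τ → E))) := by
    constructor
    · rintro ⟨_, i, rfl⟩
      exact hv.1 i
    · rintro ⟨_, i, rfl⟩ ⟨_, j, rfl⟩ hij
      exact hv.2 fun h => hij (Subtype.ext (congrArg Sum.inl h))
  obtain ⟨b, hb⟩ := hrange.exists_orthonormalBasis_extension_of_card_eq hE
  exact ⟨b, fun i => hb _ (Set.mem_range_self i)⟩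

theorem exists_linearIsometry_of_orthonormal [FiniteDimensional 𝕜 E] {D : ℕ}
    (hD : Module.finrank 𝕜 E ≤ D) {v : Fin D → F} (hv : Orthonormal 𝕜 v) :
    ∃ κ : E →ₗᵢ[𝕜] F, ∀ y, (∀ j, inner 𝕜 y (v j) = 0) → ∀ x, inner 𝕜 y (κ x) = 0 := by
  let b := stdOrthonormalBasis 𝕜 E
  let κ := b.toBasis.constr 𝕜 fun i => v (Fin.castLE hD i)
  have hκb : κ ∘ b.toBasis = v ∘ Fin.castLE hD := funext (b.toBasis.constr_basis 𝕜 _)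
  refine ⟨κ.isometryOfOrthonormal (v := b.toBasis) ?_ ?_, fun y hy x => ?_⟩
  · rw [b.coe_toBasis]
    exact b.orthonormal
  · rw [hκb]
    exact hv.comp _ (Fin.castLE_injective hD)
  · rw [LinearMap.coe_isometryOfOrthonormal, Module.Basis.constr_apply_fintype, inner_sum]
    simp only [inner_smul_right, hy, mul_zero, Finset.sum_const_zero]

variable [FiniteDimensional 𝕜 E] [FiniteDimensional 𝕜 F]

theorem norm_adjoint_linearIsometry_apply_le (κ : E →ₗᵢ[𝕜] F) (y : F) :
    ‖LinearMap.adjoint κ.toLinearMap y‖ ≤ ‖y‖ := by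
  set x := LinearMap.adjoint κ.toLinearMap y
  have hsq : ‖x‖ * ‖x‖ ≤ ‖x‖ * ‖y‖ := by
    calc ‖x‖ * ‖x‖ = RCLike.re (inner 𝕜 (κ x) y) := by
          rw [← inner_self_eq_norm_mul_norm (𝕜 := 𝕜)]
          exact congrArg RCLike.re (LinearMap.adjoint_inner_right _ x y)
      _ ≤ ‖x‖ * ‖y‖ := (re_inner_le_norm _ _).trans_eq (by rw [κ.norm_map])
  rcases (norm_nonneg x).eq_or_lt with hx | hx
  · rw [← hx]
    exact norm_nonneg y
  · exact le_of_mul_le_mul_left hsq hx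

end Dilation

section EigenframeDilation

variable {𝕜 E ι : Type*} [RCLike 𝕜] [NormedAddCommGroup E] [InnerProductSpace 𝕜 E]
  [FiniteDimensional 𝕜 E] [Fintype ι] {D : ℕ}

theorem IsEigenframe.exists_orthonormalBasis_dilation {S : E →ₗ[𝕜] E} {μ : ι → ℝ} {f : ι → E}
    (hf : IsEigenframe S μ f) {κ : E →ₗᵢ[𝕜] EuclideanSpace 𝕜 (ι ⊕ Fin D)}
    {u : ι → EuclideanSpace 𝕜 (ι ⊕ Fin D)} (hu : Orthonormal 𝕜 u)
    (hκ : ∀ i x, inner 𝕜 (u i) (κ x) = 0) :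
    ∃ b : OrthonormalBasis (ι ⊕ Fin D) 𝕜 (EuclideanSpace 𝕜 (ι ⊕ Fin D)),
      (∀ i, f i ≠ 0 → b (Sum.inl i) = κ (f i)) ∧
        ∀ i, LinearMap.adjoint κ.toLinearMap (b (Sum.inl i)) = f i := by
  obtain ⟨v, hv, hvκ, hadj⟩ := hf.exists_orthonormal_dilation κ hu hκ
  obtain ⟨b, hbv⟩ := exists_orthonormalBasis_inl_eq hv finrank_euclideanSpace
  exact ⟨b, fun i hi => (hbv i).trans (hvκ i hi), fun i => by rw [hbv, hadj]⟩

theorem exists_adjoint_repr_symm_eq_sum_add {f : ι → E}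
    {κ : E →ₗᵢ[𝕜] EuclideanSpace 𝕜 (ι ⊕ Fin D)}
    {b : OrthonormalBasis (ι ⊕ Fin D) 𝕜 (EuclideanSpace 𝕜 (ι ⊕ Fin D))}
    (hb : ∀ i, f i ≠ 0 → b (Sum.inl i) = κ (f i))
    (hadj : ∀ i, LinearMap.adjoint κ.toLinearMap (b (Sum.inl i)) = f i) (w : ι ⊕ Fin D → 𝕜) :
    ∃ t : E, LinearMap.adjoint κ.toLinearMap (b.repr.symm (WithLp.toLp 2 w)) =
        ∑ i, w (Sum.inl i) • f i + t ∧
      (∀ i, inner 𝕜 (f i) t = 0) ∧ ‖t‖ ^ 2 ≤ ∑ j, ‖w (Sum.inr j)‖ ^ 2 := by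
  refine ⟨LinearMap.adjoint κ.toLinearMap (∑ j, w (Sum.inr j) • b (Sum.inr j)), ?_, fun i => ?_, ?_⟩
  · rw [← b.sum_repr_symm, Fintype.sum_sum_type, map_add, map_sum (LinearMap.adjoint _)]
    simp only [map_smul, hadj]
  · rcases eq_or_ne (f i) 0 with hi | hi
    · rw [hi, inner_zero_left]
    · rw [LinearMap.adjoint_inner_right, LinearIsometry.coe_toLinearMap, ← hb i hi, inner_sum]
      simp only [inner_smul_right, b.orthonormal.2 Sum.inl_ne_inr, mul_zero, Finset.sum_const_zero]
  · refine (pow_le_pow_left₀ (norm_nonneg _)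
      (norm_adjoint_linearIsometry_apply_le κ _) 2).trans_eq ?_
    have hsum : ∑ j, w (Sum.inr j) • b (Sum.inr j) =
        b.repr.symm (WithLp.toLp 2 (Sum.elim 0 fun j => w (Sum.inr j))) := by
      rw [← b.sum_repr_symm, Fintype.sum_sum_type]
      simp only [Sum.elim_inl, Sum.elim_inr, Pi.zero_apply, zero_smul, Finset.sum_const_zero,
        zero_add]
    rw [hsum, LinearIsometryEquiv.norm_map, EuclideanSpace.norm_sq_eq, Fintype.sum_sum_type]
    simp only [Sum.elim_inl, Sum.elim_inr, Pi.zero_apply, norm_zero, ne_eq, OfNat.ofNat_ne_zero,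
      not_false_eq_true, zero_pow, Finset.sum_const_zero, zero_add]

theorem IsEigenframe.sum_eigenvalue_mul_le_of_le {X Y : E →ₗ[𝕜] E} {μ : ι → ℝ} {e f : ι → E}
    (he : IsEigenframe X μ e) (hf : IsEigenframe Y μ f) (hX : X.IsPositive) (hXY : X ≤ Y)
    (hμ : ∀ i, 0 ≤ μ i) (c : ι → 𝕜) {t : E} (ht : ∀ i, inner 𝕜 (f i) t = 0) :
    ∑ i, μ i * ‖inner 𝕜 (e i) (∑ i, c i • f i + t)‖ ^ 2 ≤
      ∑ i, μ i * ‖c i‖ ^ 2 + ‖LinearMap.toContinuousLinearMap Y‖ * ‖t‖ ^ 2 := by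
  set v := ∑ i, c i • f i + t
  have hY : Y.IsSymmetric := by
    rw [← sub_add_cancel Y X]
    exact (LinearMap.le_def X Y |>.mp hXY).isSymmetric.add hX.isSymmetric
  have hquad : RCLike.re (inner 𝕜 v (X v)) ≤ RCLike.re (inner 𝕜 v (Y v)) := by
    have := (LinearMap.le_def X Y |>.mp hXY).re_inner_nonneg_right v
    rwa [LinearMap.sub_apply, inner_sub_right, map_sub, sub_nonneg] at this
  exact (he.sum_eigenvalue_mul_le_re_inner hX v).trans
    (hquad.trans (hf.re_inner_le_sum_eigenvalue_mul_add hY hμ c ht))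

end EigenframeDilation

section LineStep

variable {L : Type*} [Fintype L] [DecidableEq L]

/-- `U` takes the amplitudes `√r` to the amplitudes `√l` and, followed by the projection onto the
support of `l`, does not increase the quadratic form of `diag z`. This is the shape in which a line
transition `l → r` enters the protocol, which plays the point game backwards. -/
structure IsLineStep (z : L → ℝ) (l r : L → ℝ≥0) (U : Matrix L L ℂ) : Prop where
  unitary : U ∈ Matrix.unitaryGroup L ℂ
  map : U.mulVec (fun a => ((√(r a : ℝ) : ℝ) : ℂ)) = fun a => ((√(l a : ℝ) : ℝ) : ℂ)
  le : ∀ w : L → ℂ,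
    ∑ a, (if l a = 0 then 0 else z a * ‖U.mulVec w a‖ ^ 2) ≤ ∑ a, z a * ‖w a‖ ^ 2

theorem IsLineStep.refl {z : L → ℝ} (hz : ∀ a, 0 ≤ z a) (l : L → ℝ≥0) :
    IsLineStep z l l (1 : Matrix L L ℂ) where
  unitary := one_mem _
  map := Matrix.one_mulVec _
  le w := by
    refine Finset.sum_le_sum fun a _ => ?_
    rw [Matrix.one_mulVec]
    split_ifs
    · exact mul_nonneg (hz a) (sq_nonneg _)
    · exact le_rfl

end LineStep

section Label

/-- Basis labels of a party: the coordinates in `T`, followed by `D` labels which provide room for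
dilating the operators of a line transition. -/
abbrev Label (T : Finset ℝ≥0) (D : ℕ) : Type := T ⊕ Fin D

variable {T : Finset ℝ≥0} {D : ℕ}

/-- The dual value of a label. The further labels all have the value `D`, which for large `D`
dominates the operators of finitely many line transitions. -/
def Label.value : Label T D → ℝ :=
  Sum.elim (fun x => ((x : ℝ≥0) : ℝ)) (fun _ => (D : ℝ))

/-- A function on a line as a function on labels, vanishing on the further labels. -/
def onLabels (l : ℝ≥0 → ℝ≥0) : Label T D → ℝ≥0 :=
  Sum.elim (fun x => l x) 0

theorem Label.value_nonneg : ∀ a : Label T D, 0 ≤ Label.value a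
  | Sum.inl x => x.1.2
  | Sum.inr _ => Nat.cast_nonneg D

theorem sqrt_onLabels (l : ℝ≥0 → ℝ≥0) :
    (fun a : Label T D => ((√(onLabels l a : ℝ) : ℝ) : ℂ)) =
      Sum.elim (fun x : T => ((√(l x : ℝ) : ℝ) : ℂ)) 0 := by
  funext a
  rcases a with x | j
  · rfl
  · exact congrArg Complex.ofReal Real.sqrt_zero

theorem isLineStep_toMatrix {E : Type*} [NormedAddCommGroup E] [InnerProductSpace ℂ E]
    [FiniteDimensional ℂ E] {X Y : E →ₗ[ℂ] E} (hX : X.IsPositive) (hXY : X ≤ Y)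
    (hYD : ‖LinearMap.toContinuousLinearMap Y‖ ≤ D) {l r : ℝ≥0 → ℝ≥0} {e f : T → E}
    (he : IsEigenframe X (fun x : T => ((x : ℝ≥0) : ℝ)) e)
    (hf : IsEigenframe Y (fun x : T => ((x : ℝ≥0) : ℝ)) f)
    (hl : ∀ x : T, l x ≠ 0 → e x ≠ 0) (hr : ∀ x : T, r x ≠ 0 → f x ≠ 0)
    (hlr : ∑ x : T, ((√(l x : ℝ) : ℝ) : ℂ) • e x = ∑ x : T, ((√(r x : ℝ) : ℝ) : ℂ) • f x)
    {κ : E →ₗᵢ[ℂ] EuclideanSpace ℂ (Label T D)}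
    {be bf : OrthonormalBasis (Label T D) ℂ (EuclideanSpace ℂ (Label T D))}
    (hbe : ∀ x, e x ≠ 0 → be (Sum.inl x) = κ (e x))
    (hbf : ∀ x, f x ≠ 0 → bf (Sum.inl x) = κ (f x))
    (hbf' : ∀ x, LinearMap.adjoint κ.toLinearMap (bf (Sum.inl x)) = f x) :
    IsLineStep Label.value (onLabels l) (onLabels r) (be.toBasis.toMatrix bf) where
  unitary := be.toMatrix_orthonormalBasis_mem_unitary bf
  map := by
    have hsqrt {l : ℝ≥0 → ℝ≥0} {x : T} (hx : ((√(l x : ℝ) : ℝ) : ℂ) ≠ 0) : l x ≠ 0 := by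
      rintro h
      rw [h, NNReal.coe_zero, Real.sqrt_zero] at hx
      exact hx rfl
    funext a
    rw [toMatrix_mulVec_apply_eq_inner, sqrt_onLabels, ← sum_smul_inl_eq_repr_symm,
      ← linearIsometry_map_sum_smul hbf fun x hx => hr x (hsqrt hx), ← hlr,
      linearIsometry_map_sum_smul hbe fun x hx => hl x (hsqrt hx), sum_smul_inl_eq_repr_symm,
      ← be.repr_apply_apply, be.repr.apply_symm_apply, ← sqrt_onLabels]
  le w := by
    obtain ⟨t, hsum, hft, ht⟩ := exists_adjoint_repr_symm_eq_sum_add hbf hbf' w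
    calc ∑ a, (if onLabels l a = 0 then 0 else
          Label.value a * ‖(be.toBasis.toMatrix bf).mulVec w a‖ ^ 2)
        ≤ ∑ x : T, ((x : ℝ≥0) : ℝ) * ‖inner ℂ (e x) (∑ x, w (Sum.inl x) • f x + t)‖ ^ 2 := by
          rw [Fintype.sum_sum_type]
          refine (add_le_of_nonpos_right
            (Finset.sum_nonpos fun j _ => (if_pos rfl).le)).trans (Finset.sum_le_sum fun x _ => ?_)
          split_ifs with hx
          · exact mul_nonneg x.1.2 (sq_nonneg _)
          · rw [toMatrix_mulVec_apply_eq_inner, hbe x (hl x hx), ← hsum,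
              LinearMap.adjoint_inner_right]
            rfl
      _ ≤ ∑ x : T, ((x : ℝ≥0) : ℝ) * ‖w (Sum.inl x)‖ ^ 2 +
            ‖LinearMap.toContinuousLinearMap Y‖ * ‖t‖ ^ 2 :=
          he.sum_eigenvalue_mul_le_of_le hf hX hXY (fun x => x.1.2) _ hft
      _ ≤ ∑ x : T, ((x : ℝ≥0) : ℝ) * ‖w (Sum.inl x)‖ ^ 2 +
            D * ∑ j, ‖w (Sum.inr j)‖ ^ 2 := by gcongr
      _ = ∑ a, Label.value a * ‖w a‖ ^ 2 := by
          rw [Fintype.sum_sum_type, Finset.mul_sum]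
          rfl

theorem EBMLine.eventually_isLineStep {l r : ℝ≥0 → ℝ≥0} (hlr : EBMLine l r)
    (hl : ∀ z, l z ≠ 0 → z ∈ T) (hr : ∀ z, r z ≠ 0 → z ∈ T) :
    ∀ᶠ D : ℕ in Filter.atTop, ∃ U : Matrix (Label T D) (Label T D) ℂ,
      IsLineStep Label.value (onLabels l) (onLabels r) U := by
  obtain ⟨d, X, Y, ψ, hX, hXY, hlX, hrY⟩ := hlr
  have hY : Y.PosSemidef := by
    rw [← sub_add_cancel Y X]
    exact hXY.add hX
  have hle : X.toEuclideanLin ≤ Y.toEuclideanLin := by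
    rw [LinearMap.le_def, ← map_sub]
    exact Matrix.isPositive_toEuclideanLin_iff.mpr hXY
  obtain ⟨e, he, hle₀, hesum⟩ := exists_isEigenframe_of_prob hX hlX hl
  obtain ⟨f, hf, hrf₀, hfsum⟩ := exists_isEigenframe_of_prob hY hrY hr
  filter_upwards [Filter.eventually_ge_atTop (Module.finrank ℂ (EuclideanSpace ℂ (Fin d))),
    tendsto_natCast_atTop_atTop.eventually_ge_atTop
      ‖LinearMap.toContinuousLinearMap Y.toEuclideanLin‖] with D hdD hYD
  have hstd := (EuclideanSpace.basisFun (Label T D) ℂ).orthonormal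
  obtain ⟨κ, hκ⟩ := exists_linearIsometry_of_orthonormal hdD (hstd.comp _ Sum.inr_injective)
  have hκinl (x : T) := hκ _ fun j => hstd.2 (Sum.inl_ne_inr (a := x) (b := j))
  obtain ⟨be, hbe, -⟩ := he.exists_orthonormalBasis_dilation
    (hstd.comp _ Sum.inl_injective) hκinl
  obtain ⟨bf, hbf, hbf'⟩ := hf.exists_orthonormalBasis_dilation
    (hstd.comp _ Sum.inl_injective) hκinl
  exact ⟨_, isLineStep_toMatrix (Matrix.isPositive_toEuclideanLin_iff.mpr hX) hle hYD he hf hle₀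
    hrf₀ (hesum.trans hfsum.symm) hbe hbf hbf'⟩

end Label

/-! ## Operators on registers and messages -/

section MirrorImage

variable {A B : Type}

/-- Exchange of the roles of the two parties, on Bob's side of `𝒜 ⊗ ℳ ⊗ ℬ` with `ℳ = 𝒜 ⊗ ℬ`. -/
def mirror : (A × B) × B ≃ B × B × A where
  toFun x := (x.2, x.1.2, x.1.1)
  invFun x := ((x.2.2, x.2.1), x.1)
  left_inv _ := rfl
  right_inv _ := rfl

/-- Exchange of the roles of the two parties, on `𝒜 ⊗ ℳ ⊗ ℬ` with `ℳ = 𝒜 ⊗ ℬ`. -/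
def reverse : A × (A × B) × B ≃ B × (B × A) × A where
  toFun x := (x.2.2, x.2.1.swap, x.1)
  invFun x := (x.2.2, x.2.1.swap, x.1)
  left_inv _ := rfl
  right_inv _ := rfl

theorem liftMB_submatrix_mirror [DecidableEq A] (X : Matrix (B × B × A) (B × B × A) ℂ) :
    liftMB (X.submatrix mirror mirror) = (liftAM X).submatrix reverse reverse := by
  ext ⟨a, ⟨c, m⟩, b⟩ ⟨a', ⟨c', m'⟩, b'⟩
  exact mul_comm _ _

theorem one_kronecker_eq_submatrix_mirror [DecidableEq A] [DecidableEq B] (Z : Matrix B B ℂ) :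
    (1 : Matrix (A × B) (A × B) ℂ) ⊗ₖ Z =
      (Z ⊗ₖ (1 : Matrix (B × A) (B × A) ℂ)).submatrix mirror mirror := by
  ext ⟨⟨a, m⟩, b⟩ ⟨⟨a', m'⟩, b'⟩
  simp only [mirror, Matrix.kroneckerMap_apply, Matrix.one_apply, Matrix.submatrix_apply,
    Equiv.coe_fn_mk, Prod.mk.injEq, and_comm, mul_comm]

theorem isStarProjection_submatrix {R m n : Type*} [Semiring R] [StarRing R] [Fintype m]
    [Fintype n] (e : m ≃ n) {X : Matrix n n R} (hX : IsStarProjection X) :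
    IsStarProjection (X.submatrix e e) where
  isIdempotentElem := by
    rw [IsIdempotentElem, Matrix.submatrix_mul_equiv, hX.isIdempotentElem.eq]
  isSelfAdjoint := by
    rw [IsSelfAdjoint, Matrix.star_eq_conjTranspose, Matrix.conjTranspose_submatrix,
      ← Matrix.star_eq_conjTranspose, hX.isSelfAdjoint.star_eq]

theorem submatrix_mem_unitaryGroup {R m n : Type*} [CommRing R] [StarRing R] [Fintype m]
    [Fintype n] [DecidableEq m] [DecidableEq n] (e : m ≃ n) {X : Matrix n n R}
    (hX : X ∈ Matrix.unitaryGroup n R) : X.submatrix e e ∈ Matrix.unitaryGroup m R := by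
  rw [Matrix.mem_unitaryGroup_iff, Matrix.star_eq_conjTranspose] at hX ⊢
  rw [Matrix.conjTranspose_submatrix, Matrix.submatrix_mul_equiv, hX, Matrix.submatrix_one_equiv]

end MirrorImage

section BasisProjection

variable {n : Type*} [DecidableEq n]

/-- The orthogonal projector onto the span of the basis vectors in `s`. -/
noncomputable def basisProj (s : Set n) : Matrix n n ℂ :=
  Matrix.diagonal (s.indicator 1)

theorem posSemidef_basisProj (s : Set n) : (basisProj s).PosSemidef :=
  Matrix.PosSemidef.diagonal <| Set.indicator_nonneg fun _ _ => zero_le_one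

theorem basisProj_compl_add_self (s : Set n) : basisProj sᶜ + basisProj s = 1 := by
  rw [basisProj, basisProj, Matrix.diagonal_add, ← Matrix.diagonal_one]
  exact congrArg _ (Set.indicator_compl_add_self s 1)

variable [Fintype n]

theorem basisProj_mulVec (s : Set n) (v : n → ℂ) : (basisProj s).mulVec v = s.indicator v := by
  funext x
  rw [basisProj, Matrix.mulVec_diagonal, ← Set.indicator_mul_left]
  simp only [Pi.one_apply, one_mul]

theorem isStarProjection_basisProj (s : Set n) : IsStarProjection (basisProj s) where
  isIdempotentElem := by
    rw [IsIdempotentElem, basisProj, Matrix.diagonal_mul_diagonal]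
    simp only [← Set.indicator_mul, Pi.one_apply, one_mul]
    rfl
  isSelfAdjoint := (posSemidef_basisProj s).isHermitian

theorem basisProj_mul_diagonal_mul_basisProj (s : Set n) (d : n → ℂ) :
    basisProj s * Matrix.diagonal d * basisProj s = Matrix.diagonal (s.indicator d) := by
  rw [basisProj, Matrix.diagonal_mul_diagonal, Matrix.diagonal_mul_diagonal]
  congr 1
  funext i
  by_cases hi : i ∈ s <;> simp [hi]

theorem diagonal_mulVec_single (d : n → ℂ) (i : n) :
    (Matrix.diagonal d).mulVec (Pi.single i 1) = d i • Pi.single i 1 := by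
  rw [Matrix.mulVec_single_one]
  funext j
  rw [Matrix.col_apply, Matrix.diagonal_apply, Pi.smul_apply, Pi.single_apply, smul_eq_mul]
  split_ifs with hji
  · rw [hji, mul_one]
  · rw [mul_zero]

theorem posSemidef_diagonal_sub {𝕜 : Type*} [RCLike 𝕜] {w d : n → ℝ}
    {C : Matrix n n 𝕜} (h : ∀ v : n → 𝕜, ∑ i, d i * ‖C.mulVec v i‖ ^ 2 ≤ ∑ i, w i * ‖v i‖ ^ 2) :
    (Matrix.diagonal (fun i => (w i : 𝕜)) -
      C.conjTranspose * Matrix.diagonal (fun i => (d i : 𝕜)) * C).PosSemidef := by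
  have hdiag (w : n → ℝ) : (Matrix.diagonal fun i => (w i : 𝕜)).IsHermitian :=
    Matrix.isHermitian_diagonal_of_self_adjoint _ <| funext fun i => RCLike.conj_ofReal (w i)
  have hquad (w : n → ℝ) (v : n → 𝕜) : star v ⬝ᵥ (Matrix.diagonal fun i => (w i : 𝕜)).mulVec v =
      ((∑ i, w i * ‖v i‖ ^ 2 : ℝ) : 𝕜) := by
    simp only [dotProduct, Matrix.mulVec_diagonal, Pi.star_apply, RCLike.star_def,
      mul_left_comm (starRingEnd 𝕜 _), RCLike.conj_mul]
    push_cast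
    rfl
  refine Matrix.PosSemidef.of_dotProduct_mulVec_nonneg
    ((hdiag w).sub (Matrix.isHermitian_conjTranspose_mul_mul C (hdiag d))) fun v => ?_
  rw [Matrix.sub_mulVec, dotProduct_sub, hquad, ← Matrix.mulVec_mulVec, ← Matrix.mulVec_mulVec,
    Matrix.dotProduct_mulVec, ← Matrix.star_mulVec, hquad, ← RCLike.ofReal_sub]
  exact RCLike.ofReal_nonneg.mpr (sub_nonneg.mpr (h v))

end BasisProjection

section Controlled

variable {L C : Type*} [DecidableEq L]

/-- On basis states `|a⟩|m, c⟩`, exchanges `|o⟩` and `|a⟩` in the register of `m`. -/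
def swapCopy (o : L) : L × L × C ≃ L × L × C where
  toFun x := (x.1, Equiv.swap o x.1 x.2.1, x.2.2)
  invFun x := (x.1, Equiv.swap o x.1 x.2.1, x.2.2)
  left_inv x := by simp
  right_inv x := by simp

/-- Erases the copy of `a` in `|a⟩|a, c⟩`, applies `V c` to the first register, and makes a new
copy. -/
def controlled [DecidableEq C] (o : L) (V : C → Matrix L L ℂ) :
    Matrix (L × L × C) (L × L × C) ℂ :=
  (Matrix.blockDiagonal fun m : L × C => V m.2).submatrix (swapCopy o) (swapCopy o)

/-- The basis states `|a⟩|a, c⟩` with `q a c ≠ 0`, on which a party checks that the label `c` sent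
by the other party is consistent with her own label `a`. -/
def copySupport (q : L → C → ℝ≥0) : Set (L × L × C) :=
  {x | x.2.1 = x.1 ∧ q x.1 x.2.2 ≠ 0}

variable [Fintype L] [Fintype C] [DecidableEq C]

theorem controlled_mem_unitaryGroup (o : L) {V : C → Matrix L L ℂ}
    (hV : ∀ c, V c ∈ Matrix.unitaryGroup L ℂ) :
    controlled o V ∈ Matrix.unitaryGroup (L × L × C) ℂ := by
  refine submatrix_mem_unitaryGroup _ ?_
  have hVV : (fun m : L × C => V m.2 * (V m.2).conjTranspose) = 1 :=
    funext fun m => Matrix.mem_unitaryGroup_iff.mp (hV m.2)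
  rw [Matrix.mem_unitaryGroup_iff, Matrix.star_eq_conjTranspose, Matrix.blockDiagonal_conjTranspose,
    ← Matrix.blockDiagonal_mul, hVV, Matrix.blockDiagonal_one]

theorem controlled_mulVec_apply (o : L) (V : C → Matrix L L ℂ) (v : L × L × C → ℂ) (a m : L)
    (c : C) : (controlled o V).mulVec v (a, m, c) =
      ∑ a', V c a a' * v (a', Equiv.swap o a' (Equiv.swap o a m), c) := by
  rw [controlled, Matrix.submatrix_mulVec_equiv, Function.comp_apply, Matrix.mulVec, dotProduct,
    Fintype.sum_prod_type]
  refine Finset.sum_congr rfl fun a' _ => ?_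
  rw [Finset.sum_eq_single (Equiv.swap o a m, c)]
  · rw [swapCopy, Equiv.coe_fn_mk, Matrix.blockDiagonal_apply_eq]
    rfl
  · intro y _ hy
    rw [swapCopy, Equiv.coe_fn_mk, Matrix.blockDiagonal_apply_ne _ _ _ hy.symm, zero_mul]
  · exact fun h => absurd (Finset.mem_univ _) h

theorem controlled_mulVec_self (o : L) (V : C → Matrix L L ℂ) (v : L × L × C → ℂ) (a : L) (c : C) :
    (controlled o V).mulVec v (a, a, c) = (V c).mulVec (fun a' => v (a', a', c)) a := by
  rw [controlled_mulVec_apply]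
  simp only [Equiv.swap_apply_right, Equiv.swap_apply_left, Matrix.mulVec, dotProduct]

theorem controlled_mulVec_copy (o : L) (V : C → Matrix L L ℂ) (u : L → C → ℂ) :
    (controlled o V).mulVec (fun y => if y.2.1 = y.1 then u y.1 y.2.2 else 0) =
      fun y => if y.2.1 = y.1 then (V y.2.2).mulVec (fun a => u a y.2.2) y.1 else 0 := by
  funext ⟨a, m, c⟩
  by_cases hma : m = a
  · subst hma
    simp only [controlled_mulVec_self, if_true]
  · rw [controlled_mulVec_apply, if_neg hma, Finset.sum_eq_zero]
    intro a' _
    rw [if_neg, mul_zero]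
    intro hcopy
    rw [Equiv.swap_apply_eq_iff, Equiv.swap_apply_right, Equiv.swap_apply_eq_iff,
      Equiv.swap_apply_left] at hcopy
    exact hma hcopy

theorem sum_indicator_copySupport_le (o : L) {V : C → Matrix L L ℂ} {q : L → C → ℝ≥0}
    {z z' : L → ℝ} (hz : ∀ a, 0 ≤ z a)
    (h : ∀ c (w : L → ℂ), ∑ a, (if q a c = 0 then 0 else z' a * ‖(V c).mulVec w a‖ ^ 2) ≤
      ∑ a, z a * ‖w a‖ ^ 2) (v : L × L × C → ℂ) :
    ∑ x, (copySupport q).indicator (fun x => z' x.1) x * ‖(controlled o V).mulVec v x‖ ^ 2 ≤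
      ∑ x, z x.1 * ‖v x‖ ^ 2 := by
  have hsum (g : L × L × C → ℝ) : ∑ x, g x = ∑ c, ∑ a, ∑ m, g (a, m, c) := by
    simp only [Fintype.sum_prod_type, Fintype.sum_prod_type_right (f := fun y : L × C => g (_, y))]
    exact Finset.sum_comm
  rw [hsum, hsum]
  refine Finset.sum_le_sum fun c _ => ?_
  calc ∑ a, ∑ m, (copySupport q).indicator (fun x => z' x.1) (a, m, c) *
          ‖(controlled o V).mulVec v (a, m, c)‖ ^ 2
      = ∑ a, (if q a c = 0 then 0 else
          z' a * ‖(V c).mulVec (fun a' => v (a', a', c)) a‖ ^ 2) := by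
        refine Finset.sum_congr rfl fun a _ => (Finset.sum_eq_single a ?_ ?_).trans ?_
        · exact fun m _ hm => by rw [Set.indicator_of_notMem fun hx => hm hx.1, zero_mul]
        · exact fun ha => absurd (Finset.mem_univ _) ha
        · rw [controlled_mulVec_self]
          split_ifs with hq
          · rw [Set.indicator_of_notMem fun hx => hx.2 hq, zero_mul]
          · rw [Set.indicator_of_mem (show (a, a, c) ∈ copySupport q from ⟨rfl, hq⟩)]
    _ ≤ ∑ a, z a * ‖v (a, a, c)‖ ^ 2 := h c _
    _ ≤ ∑ a, ∑ m, z a * ‖v (a, m, c)‖ ^ 2 :=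
        Finset.sum_le_sum fun a _ =>
          Finset.single_le_sum (f := fun m => z a * ‖v (a, m, c)‖ ^ 2)
            (fun m _ => mul_nonneg (hz a) (sq_nonneg _)) (Finset.mem_univ a)

theorem posSemidef_kronecker_sub_controlled (o : L) {V : C → Matrix L L ℂ} {q : L → C → ℝ≥0}
    {z z' : L → ℝ} (hz : ∀ a, 0 ≤ z a)
    (h : ∀ c (w : L → ℂ), ∑ a, (if q a c = 0 then 0 else z' a * ‖(V c).mulVec w a‖ ^ 2) ≤
      ∑ a, z a * ‖w a‖ ^ 2) :
    ((Matrix.diagonal fun a => (z a : ℂ)) ⊗ₖ (1 : Matrix (L × C) (L × C) ℂ) -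
      (controlled o V).conjTranspose * basisProj (copySupport q) *
        ((Matrix.diagonal fun a => (z' a : ℂ)) ⊗ₖ (1 : Matrix (L × C) (L × C) ℂ)) *
          basisProj (copySupport q) * controlled o V).PosSemidef := by
  have hkron (z : L → ℝ) : (Matrix.diagonal fun a => (z a : ℂ)) ⊗ₖ
      (1 : Matrix (L × C) (L × C) ℂ) = Matrix.diagonal fun x : L × L × C => ((z x.1 : ℝ) : ℂ) := by
    simp only [← Matrix.diagonal_one, Matrix.diagonal_kronecker_diagonal, mul_one]
  have hcheck : basisProj (copySupport q) * (Matrix.diagonal fun x => ((z' x.1 : ℝ) : ℂ)) *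
      basisProj (copySupport q) = Matrix.diagonal fun x =>
        (((copySupport q).indicator (fun x => z' x.1) x : ℝ) : ℂ) := by
    rw [basisProj_mul_diagonal_mul_basisProj]
    exact congrArg _ (Set.indicator_comp_of_zero Complex.ofReal_zero)
  rw [hkron, hkron, mul_assoc (controlled o V).conjTranspose,
    mul_assoc (controlled o V).conjTranspose, hcheck]
  exact posSemidef_diagonal_sub (sum_indicator_copySupport_le o hz h)

end Controlled

section Lift

variable {A M B : Type} [Fintype A] [Fintype M] [Fintype B] [DecidableEq B]

theorem liftAM_mulVec_apply (X : Matrix (A × M) (A × M) ℂ)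
    (v : A × M × B → ℂ) (a : A) (m : M) (b : B) :
    (liftAM X).mulVec v (a, m, b) = X.mulVec (fun y => v (y.1, y.2, b)) (a, m) := by
  simp only [liftAM, assocOp, Matrix.mulVec, dotProduct, Matrix.reindex_apply,
    Matrix.submatrix_apply, Fintype.sum_prod_type, Matrix.kroneckerMap_apply, Matrix.one_apply,
    Equiv.prodAssoc_symm_apply, mul_ite, mul_one, mul_zero, ite_mul, zero_mul, Finset.sum_ite_eq,
    Finset.mem_univ, if_true]

end Lift

section GameState

variable {A B : Type} [DecidableEq A] [DecidableEq B]

/-- The honest state `∑ √q(a, b) |a⟩|a, b⟩|b⟩`. -/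
noncomputable def gameState (q : A → B → ℝ≥0) : A × (A × B) × B → ℂ :=
  fun x => if x.2.1.1 = x.1 ∧ x.2.1.2 = x.2.2 then ((√(q x.1 x.2.2 : ℝ) : ℝ) : ℂ) else 0

theorem gameState_comp_reverse (q : A → B → ℝ≥0) :
    gameState (fun b a => q a b) ∘ reverse = gameState q := by
  funext x
  simp only [gameState, reverse, Function.comp_apply, Equiv.coe_fn_mk, Prod.fst_swap,
    Prod.snd_swap, and_comm]

theorem gameState_single (a : A) (b : B) :
    gameState (Pi.single a (Pi.single b 1)) = fun x =>
      Pi.single (M := fun _ => ℂ) a 1 x.1 * Pi.single (M := fun _ => ℂ) (a, b) 1 x.2.1 *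
        Pi.single (M := fun _ => ℂ) b 1 x.2.2 := by
  funext ⟨a', ⟨m, c⟩, b'⟩
  by_cases ha : a' = a
  · by_cases hb : b' = b
    · subst ha hb
      simp [gameState, Pi.single_apply]
    · simp [gameState, ha, hb]
  · simp [gameState, ha]

variable [Fintype A] [Fintype B]

theorem liftMB_submatrix_mirror_mulVec_gameState {X : Matrix (B × B × A) (B × B × A) ℂ}
    {q q' : A → B → ℝ≥0} (h : (liftAM X).mulVec (gameState fun b a => q' a b) =
      gameState fun b a => q a b) :
    (liftMB (X.submatrix mirror mirror)).mulVec (gameState q') = gameState q := by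
  rw [liftMB_submatrix_mirror, ← gameState_comp_reverse q', Matrix.submatrix_mulVec_equiv,
    Function.comp_assoc, Equiv.self_comp_symm, Function.comp_id, h, gameState_comp_reverse]

theorem liftAM_controlled_mulVec_gameState {q q' : A → B → ℝ≥0} {V : B → Matrix A A ℂ} (o : A)
    (h : ∀ b, (V b).mulVec (fun a => ((√(q' a b : ℝ) : ℝ) : ℂ)) =
      fun a => ((√(q a b : ℝ) : ℝ) : ℂ)) :
    (liftAM (controlled o V)).mulVec (gameState q') = gameState q := by
  funext ⟨a, ⟨m, c⟩, b⟩
  have hslice (q : A → B → ℝ≥0) : (fun y : A × A × B => gameState q (y.1, y.2, b)) = fun y =>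
      if y.2.1 = y.1 then (if y.2.2 = b then ((√(q y.1 b : ℝ) : ℝ) : ℂ) else 0) else 0 := by
    simp only [gameState, ite_and]
  have hcopy := controlled_mulVec_copy o V
    fun a c => if c = b then ((√(q' a b : ℝ) : ℝ) : ℂ) else 0
  rw [liftAM_mulVec_apply, hslice, hcopy]
  refine Eq.trans ?_ (congrFun (hslice q) (a, m, c)).symm
  refine if_congr Iff.rfl ?_ rfl
  by_cases hc : c = b
  · subst hc
    simp only [if_true, h c]
  · simp only [if_neg hc]
    exact congrFun (Matrix.mulVec_zero (V c)) a

theorem liftAM_basisProj_copySupport_mulVec_gameState (q : A → B → ℝ≥0) :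
    (liftAM (basisProj (copySupport q))).mulVec (gameState q) = gameState q := by
  funext ⟨a, ⟨m, c⟩, b⟩
  rw [liftAM_mulVec_apply, basisProj_mulVec, Set.indicator_apply_eq_self]
  intro hx
  refine (ite_eq_right_iff (p := m = a ∧ c = b)).mpr ?_
  rintro ⟨rfl, rfl⟩
  have hq : q m c = 0 := by
    by_contra hq
    exact hx ⟨rfl, hq⟩
  rw [hq, NNReal.coe_zero, Real.sqrt_zero, Complex.ofReal_zero]

theorem norm_ofReal_sqrt_sq (x : ℝ≥0) : ‖((√(x : ℝ) : ℝ) : ℂ)‖ ^ 2 = x := by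
  rw [Complex.norm_real, Real.norm_eq_abs, sq_abs, Real.sq_sqrt x.coe_nonneg]

theorem normSq_mul_gameState (f : A → ℂ) (g : B → ℂ) (q : A → B → ℝ≥0) :
    normSq (fun x => f x.1 * g x.2.2 * gameState q x) =
      ∑ a, ∑ b, ‖f a‖ ^ 2 * ‖g b‖ ^ 2 * q a b := by
  simp only [normSq, gameState, Fintype.sum_prod_type, ite_and, norm_mul, mul_pow,
    apply_ite (fun x : ℂ => ‖x‖ ^ 2), norm_ofReal_sqrt_sq, norm_zero, ne_eq, OfNat.ofNat_ne_zero,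
    not_false_eq_true, zero_pow, mul_ite, mul_zero, Finset.sum_ite_irrel, Finset.sum_const_zero,
    Finset.sum_ite_eq, Finset.sum_ite_eq', Finset.mem_univ, if_true]

end GameState

section NormSq

variable {A : Type} [Fintype A]

theorem normSq_single [DecidableEq A] (a : A) :
    normSq (Pi.single a (1 : ℂ) : A → ℂ) = 1 := by
  simp only [normSq, Pi.single_apply, apply_ite (fun x : ℂ => ‖x‖ ^ 2), norm_one, one_pow,
    norm_zero, ne_eq, OfNat.ofNat_ne_zero, not_false_eq_true, zero_pow, Finset.sum_ite_eq',
    Finset.mem_univ, if_true]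

theorem normSq_eq_zero {v : A → ℂ} : normSq v = 0 ↔ v = 0 := by
  rw [normSq, Finset.sum_eq_zero_iff_of_nonneg fun _ _ => sq_nonneg _]
  simp only [Finset.mem_univ, true_imp_iff, sq_eq_zero_iff, norm_eq_zero, funext_iff,
    Pi.zero_apply]

end NormSq

/-! ## The protocol of a game on labels -/

section LabelGame

/-- A point game `weight 0, …, weight N` on pairs of labels, the basis states of the two parties.
The label `a` stands for the coordinate `value a`, and step `k` of the game is carried out by the
unitaries `unitary k`, controlled by the label of the party that does not move. -/
structure LabelGame (L : Type) [Fintype L] [DecidableEq L] where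
  N : ℕ
  value : L → ℝ
  weight : ℕ → L → L → ℝ≥0
  unitary : ℕ → L → Matrix L L ℂ
  zero : L
  one : L
  /-- The label of the first coordinate of the final point. -/
  fst : L
  /-- The label of the second coordinate of the final point. -/
  snd : L
  even : Even N
  value_nonneg : ∀ a, 0 ≤ value a
  value_zero : value zero = 0
  value_one : value one = 1
  vertical : ∀ k < N, Even k → ∀ a,
    IsLineStep value (weight k a) (weight (k + 1) a) (unitary k a)
  horizontal : ∀ k < N, Odd k → ∀ b,
    IsLineStep value (fun a => weight k a b) (fun a => weight (k + 1) a b) (unitary k b)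
  init : weight 0 = Pi.single zero (Pi.single one (1 / 2)) + Pi.single one (Pi.single zero (1 / 2))
  final : weight N = Pi.single fst (Pi.single snd 1)

namespace IsLineStep

variable {L : Type*} [Fintype L] [DecidableEq L] {z : L → ℝ} {l r : L → ℝ≥0} {U : Matrix L L ℂ}

theorem sum_value_le (h : IsLineStep z l r U) : ∑ a, z a * l a ≤ ∑ a, z a * r a := by
  have hle := h.le fun a => ((√(r a : ℝ) : ℝ) : ℂ)
  simp only [h.map, norm_ofReal_sqrt_sq] at hle
  refine le_of_eq_of_le (Finset.sum_congr rfl fun a _ => ?_) hle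
  split_ifs with hla
  · rw [hla, NNReal.coe_zero, mul_zero]
  · rfl

theorem sum_eq (h : IsLineStep z l r U) : ∑ a, (l a : ℝ) = ∑ a, (r a : ℝ) := by
  have hdot (l : L → ℝ≥0) : star (fun a => ((√(l a : ℝ) : ℝ) : ℂ)) ⬝ᵥ
      (fun a => ((√(l a : ℝ) : ℝ) : ℂ)) = ((∑ a, (l a : ℝ) : ℝ) : ℂ) := by
    rw [dotProduct, Complex.ofReal_sum]
    refine Finset.sum_congr rfl fun a _ => ?_
    rw [Pi.star_apply, Complex.star_def, Complex.conj_mul', ← Complex.ofReal_pow,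
      norm_ofReal_sqrt_sq]
  have hU : U.conjTranspose * U = 1 := Matrix.mem_unitaryGroup_iff'.mp h.unitary
  apply Complex.ofReal_injective
  rw [← hdot, ← hdot, ← h.map, Matrix.star_mulVec, ← Matrix.dotProduct_mulVec,
    Matrix.mulVec_mulVec, hU, Matrix.one_mulVec]

end IsLineStep

namespace LabelGame

variable {L : Type} [Fintype L] [DecidableEq L] (G : LabelGame L)

theorem zero_ne_one : G.zero ≠ G.one := by
  intro h
  have hvalue := congrArg G.value h
  rw [G.value_zero, G.value_one] at hvalue
  norm_num at hvalue

theorem sum_weight_init (u v : L → ℝ) :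
    ∑ a, ∑ b, u a * v b * G.weight 0 a b =
      (u G.zero * v G.one + u G.one * v G.zero) / 2 := by
  simp only [G.init, Pi.add_apply, NNReal.coe_add, mul_add, Finset.sum_add_distrib]
  simp only [Pi.single_apply, ite_apply, Pi.zero_apply, apply_ite NNReal.toReal,
    NNReal.coe_zero, mul_ite, mul_zero, Finset.sum_ite_irrel, Finset.sum_const_zero,
    Finset.sum_ite_eq', Finset.mem_univ, if_true]
  push_cast
  ring

theorem sum_weight_final (u v : L → ℝ) :
    ∑ a, ∑ b, u a * v b * G.weight G.N a b = u G.fst * v G.snd := by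
  simp only [G.final, Pi.single_apply, ite_apply, Pi.zero_apply,
    apply_ite NNReal.toReal, NNReal.coe_zero, NNReal.coe_one, mul_ite, mul_zero, mul_one,
    Finset.sum_ite_irrel, Finset.sum_const_zero, Finset.sum_ite_eq', Finset.mem_univ, if_true]

theorem weight_init_le_weight_final {u v : L → ℝ} (hu : ∀ a, 0 ≤ u a) (hv : ∀ a, 0 ≤ v a)
    (hu_le : ∀ {l r : L → ℝ≥0} {U}, IsLineStep G.value l r U → ∑ a, u a * l a ≤ ∑ a, u a * r a)
    (hv_le : ∀ {l r : L → ℝ≥0} {U}, IsLineStep G.value l r U → ∑ a, v a * l a ≤ ∑ a, v a * r a) :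
    (u G.zero * v G.one + u G.one * v G.zero) / 2 ≤ u G.fst * v G.snd := by
  have hvert (k) : ∑ a, ∑ b, u a * v b * G.weight k a b =
      ∑ a, u a * ∑ b, v b * G.weight k a b := by
    simp only [Finset.mul_sum, mul_assoc]
  have hhor (k) : ∑ a, ∑ b, u a * v b * G.weight k a b =
      ∑ b, v b * ∑ a, u a * G.weight k a b := by
    rw [Finset.sum_comm]
    simp only [Finset.mul_sum, mul_assoc, mul_left_comm]
  have hmono : ∀ k ≤ G.N, ∑ a, ∑ b, u a * v b * G.weight 0 a b ≤
      ∑ a, ∑ b, u a * v b * G.weight k a b := by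
    intro k
    induction k with
    | zero => exact fun _ => le_rfl
    | succ k ih =>
      refine fun hk => (ih (by omega)).trans ?_
      rcases Nat.even_or_odd k with hk_even | hk_odd
      · rw [hvert, hvert]
        exact Finset.sum_le_sum fun a _ =>
          mul_le_mul_of_nonneg_left (hv_le (G.vertical k hk hk_even a)) (hu a)
      · rw [hhor, hhor]
        exact Finset.sum_le_sum fun b _ =>
          mul_le_mul_of_nonneg_left (hu_le (G.horizontal k hk hk_odd b)) (hv b)
  rw [← G.sum_weight_init, ← G.sum_weight_final]
  exact hmono G.N le_rfl

theorem value_fst_pos : 0 < G.value G.fst := by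
  have hle := G.weight_init_le_weight_final (v := 1) G.value_nonneg (fun _ => zero_le_one)
    IsLineStep.sum_value_le fun h => by
      simpa only [Pi.one_apply, one_mul] using h.sum_eq.le
  simp only [G.value_zero, G.value_one, Pi.one_apply] at hle
  linarith

theorem value_snd_pos : 0 < G.value G.snd := by
  have hle := G.weight_init_le_weight_final (u := 1) (fun _ => zero_le_one) G.value_nonneg
    (fun h => by simpa only [Pi.one_apply, one_mul] using h.sum_eq.le) IsLineStep.sum_value_le
  simp only [G.value_zero, G.value_one, Pi.one_apply] at hle
  linarith

theorem N_pos : 0 < G.N := by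
  refine Nat.pos_of_ne_zero fun hN => ?_
  have hinit : G.weight 0 G.zero G.one = 1 / 2 := by
    simp [G.init, G.zero_ne_one]
  have hfinal : G.weight 0 G.zero G.one = 0 ∨ G.weight 0 G.zero G.one = 1 := by
    rw [← hN, G.final]
    simp only [Pi.single_apply]
    split_ifs <;> simp [Pi.single_apply, em']
  rw [hinit] at hfinal
  norm_num at hfinal

/-- The protocol that runs the game backwards. -/
noncomputable def scheme : Scheme L (L × L) L where
  ψA := Pi.single G.fst 1
  ψM := Pi.single (G.fst, G.snd) 1
  ψB := Pi.single G.snd 1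
  UA i := controlled G.fst (G.unitary (G.N - i))
  UB i := (controlled G.snd (G.unitary (G.N - i))).submatrix mirror mirror
  EA i := basisProj (copySupport (G.weight (G.N - i)))
  EB i := (basisProj (copySupport fun b a => G.weight (G.N - i) a b)).submatrix mirror mirror
  povmA := ![basisProj {G.one}ᶜ, basisProj {G.one}]
  povmB := ![basisProj {G.one}, basisProj {G.one}ᶜ]

variable {G} {i : ℕ}

theorem horizontal_sub (hi : i < G.N) (ho : Odd (i + 1)) (b : L) :
    IsLineStep G.value (fun a => G.weight (G.N - (i + 1)) a b) (fun a => G.weight (G.N - i) a b)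
      (G.unitary (G.N - (i + 1)) b) := by
  have hN : G.N - i = G.N - (i + 1) + 1 := by omega
  rw [hN]
  exact G.horizontal _ (by omega) (Nat.Even.sub_odd hi G.even ho) b

theorem vertical_sub (hi : i < G.N) (he : Even (i + 1)) (a : L) :
    IsLineStep G.value (G.weight (G.N - (i + 1)) a) (G.weight (G.N - i) a)
      (G.unitary (G.N - (i + 1)) a) := by
  have hN : G.N - i = G.N - (i + 1) + 1 := by omega
  rw [hN]
  exact G.vertical _ (by omega) ((Nat.even_sub hi).mpr (iff_of_true G.even he)) a

theorem honest_scheme (hi : i ≤ G.N) : G.scheme.honest i = gameState (G.weight (G.N - i)) := by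
  induction i with
  | zero =>
    rw [Nat.sub_zero, G.final, gameState_single]
    rfl
  | succ i ih =>
    rw [Scheme.honest, ih (by omega), Scheme.U]
    split_ifs with ho
    · exact liftAM_controlled_mulVec_gameState _ fun b => (horizontal_sub hi ho b).map
    · exact liftMB_submatrix_mirror_mulVec_gameState <|
        liftAM_controlled_mulVec_gameState _ fun a =>
          (vertical_sub hi (Nat.not_odd_iff_even.mp ho) a).map

theorem E_mulVec_honest (hi : i ≤ G.N) :
    (G.scheme.E i).mulVec (G.scheme.honest i) = G.scheme.honest i := by
  rw [honest_scheme hi, Scheme.E]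
  split_ifs
  · exact liftAM_basisProj_copySupport_mulVec_gameState _
  · exact liftMB_submatrix_mirror_mulVec_gameState <|
      liftAM_basisProj_copySupport_mulVec_gameState _

theorem normSq_outcome_honest {c c' : Fin 2} {s t : Set L} (hs : G.scheme.povmA c = basisProj s)
    (ht : G.scheme.povmB c' = basisProj t) :
    normSq ((G.scheme.outcome c c').mulVec (G.scheme.honest G.N)) =
      (s.indicator 1 G.zero * t.indicator 1 G.one +
        s.indicator 1 G.one * t.indicator 1 G.zero) / 2 := by
  have hvec : (G.scheme.outcome c c').mulVec (G.scheme.honest G.N) = fun x =>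
      s.indicator 1 x.1 * t.indicator 1 x.2.2 * gameState (G.weight 0) x := by
    funext x
    rw [honest_scheme le_rfl, Nat.sub_self, Scheme.outcome, hs, ht, basisProj, basisProj,
      ← Matrix.diagonal_one, Matrix.diagonal_kronecker_diagonal,
      Matrix.diagonal_kronecker_diagonal, Matrix.mulVec_diagonal, one_mul]
  have hsq (s : Set L) (a : L) : ‖(s.indicator 1 a : ℂ)‖ ^ 2 = s.indicator 1 a := by
    by_cases ha : a ∈ s <;> simp [ha]
  rw [hvec, normSq_mul_gameState]
  simp only [hsq, G.sum_weight_init]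

theorem isProtocol_scheme : G.scheme.IsProtocol G.N where
  even := G.even
  ψA_unit := normSq_single _
  ψM_unit := normSq_single _
  ψB_unit := normSq_single _
  UA_unitary
    | i + 1, _, hi, ho => controlled_mem_unitaryGroup _ fun b => (horizontal_sub hi ho b).unitary
  UB_unitary
    | i + 1, _, hi, he => submatrix_mem_unitaryGroup _ <|
        controlled_mem_unitaryGroup _ fun a => (vertical_sub hi he a).unitary
  EA_proj _ _ _ _ := isStarProjection_basisProj _
  EB_proj _ _ _ _ := isStarProjection_submatrix _ (isStarProjection_basisProj _)
  E_honest _ _ hi := E_mulVec_honest hi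
  povmA_pos := Fin.forall_fin_two.mpr ⟨posSemidef_basisProj _, posSemidef_basisProj _⟩
  povmA_sum := basisProj_compl_add_self _
  povmB_pos := Fin.forall_fin_two.mpr ⟨posSemidef_basisProj _, posSemidef_basisProj _⟩
  povmB_sum := (add_comm _ _).trans (basisProj_compl_add_self _)
  correct01 := by
    rw [← normSq_eq_zero, normSq_outcome_honest rfl rfl]
    simp
  correct10 := by
    rw [← normSq_eq_zero, normSq_outcome_honest rfl rfl]
    simp [G.zero_ne_one]
  balanced_A := by
    rw [normSq_outcome_honest rfl rfl]
    simp [G.zero_ne_one]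
  balanced_B := by
    rw [normSq_outcome_honest rfl rfl]
    simp [G.zero_ne_one]

variable (G)

/-- The diagonal of the dual operators: the values of the labels before step `k`, and the indicator
of `one`, the answer on which the party loses, from step `k` on. -/
noncomputable def dualValue (k i : ℕ) : L → ℝ :=
  if i < k then G.value else ({G.one} : Set L).indicator 1

variable {G} {k : ℕ}

theorem dualValue_nonneg (a : L) : 0 ≤ G.dualValue k i a := by
  rw [dualValue]
  split_ifs
  · exact G.value_nonneg a
  · exact Set.indicator_nonneg (fun _ _ => zero_le_one) a

theorem dualValue_le (a : L) : G.dualValue k i a ≤ G.value a := by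
  rw [dualValue]
  split_ifs
  · exact le_rfl
  · exact Set.indicator_apply_le' (fun ha => ha ▸ G.value_one.ge) fun _ => G.value_nonneg a

theorem sum_dualValue_le {l r : L → ℝ≥0} {U : Matrix L L ℂ} (h : IsLineStep G.value l r U)
    (w : L → ℂ) :
    ∑ a, (if l a = 0 then 0 else G.dualValue k i a * ‖U.mulVec w a‖ ^ 2) ≤
      ∑ a, G.value a * ‖w a‖ ^ 2 := by
  refine (Finset.sum_le_sum fun a _ => ?_).trans (h.le w)
  split_ifs
  · exact le_rfl
  · exact mul_le_mul_of_nonneg_right (dualValue_le a) (sq_nonneg _)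

variable (G) in
/-- The dual operators `Z_0, Z_1, …`, see `dualValue`. -/
noncomputable def dualPoint (k i : ℕ) : Matrix L L ℂ :=
  Matrix.diagonal fun a => (G.dualValue k i a : ℂ)

theorem posSemidef_dualPoint : (G.dualPoint k i).PosSemidef :=
  Matrix.PosSemidef.diagonal fun a => Complex.zero_le_real.mpr (dualValue_nonneg a)

theorem dualPoint_of_le (hki : k ≤ i) : G.dualPoint k i = basisProj {G.one} := by
  rw [dualPoint, dualValue, if_neg hki.not_gt, basisProj]
  exact congrArg _ (Set.indicator_comp_of_zero Complex.ofReal_zero).symm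

theorem dualPoint_mulVec_single (hik : i < k) (a : L) :
    (G.dualPoint k i).mulVec (Pi.single a 1) = ((G.value a : ℝ) : ℂ) • Pi.single a 1 := by
  rw [dualPoint, diagonal_mulVec_single, dualValue, if_pos hik]

theorem posSemidef_dualPoint_sub {q q' : L → L → ℝ≥0} {V : L → Matrix L L ℂ} (hik : i < k)
    (o : L) (h : ∀ c, IsLineStep G.value (fun a => q a c) (fun a => q' a c) (V c)) :
    (G.dualPoint k i ⊗ₖ (1 : Matrix (L × L) (L × L) ℂ) -
      (controlled o V).conjTranspose * basisProj (copySupport q) *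
        (G.dualPoint k (i + 1) ⊗ₖ (1 : Matrix (L × L) (L × L) ℂ)) *
          basisProj (copySupport q) * controlled o V).PosSemidef := by
  refine posSemidef_kronecker_sub_controlled o dualValue_nonneg fun c w => ?_
  have hz : G.dualValue k i = G.value := if_pos hik
  rw [hz]
  exact sum_dualValue_le (h c) w

theorem dualFeasibleA_scheme :
    G.scheme.DualFeasibleA G.N (G.dualPoint (G.N - 1)) (G.value G.fst) where
  pos _ _ := posSemidef_dualPoint
  odd i hi ho := by
    have hi' : i < G.N - 1 := by grind [G.even]
    exact posSemidef_dualPoint_sub hi' G.fst fun b => horizontal_sub hi ho b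
  even i hi he := by
    have hiff : i < G.N - 1 ↔ i + 1 < G.N - 1 := by grind [G.even]
    simp only [dualPoint, dualValue, hiff]
  final := dualPoint_of_le (Nat.sub_le _ _)
  eigenvalue_pos := G.value_fst_pos
  eigenvector := dualPoint_mulVec_single (by grind [G.even, G.N_pos]) _

theorem dualFeasibleB_scheme :
    G.scheme.DualFeasibleB G.N (G.dualPoint G.N) (G.value G.snd) where
  pos _ _ := posSemidef_dualPoint
  even i hi he := by
    convert (posSemidef_dualPoint_sub hi G.snd fun a => vertical_sub hi he a).submatrix
      (mirror : (L × L) × L ≃ L × L × L) using 1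
    simp only [scheme, one_kronecker_eq_submatrix_mirror, Matrix.conjTranspose_submatrix,
      Matrix.submatrix_mul_equiv]
    rfl
  odd i hi ho := by
    have hiff : i < G.N ↔ i + 1 < G.N := by grind [G.even]
    simp only [dualPoint, dualValue, hiff]
  final := dualPoint_of_le le_rfl
  eigenvalue_pos := G.value_snd_pos
  eigenvector := dualPoint_mulVec_single G.N_pos _

end LabelGame

end LabelGame

/-! ## Point games as games on labels -/

section PointGame

variable {T : Finset ℝ≥0} {D : ℕ}

/-- A function on the plane as a function on pairs of labels. -/
def onLabelPairs (p : ℝ≥0 × ℝ≥0 → ℝ≥0) (a b : Label T D) : ℝ≥0 :=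
  onLabels (fun x => onLabels (fun y => p (x, y)) b) a

theorem onLabelPairs_comp_swap (p : ℝ≥0 × ℝ≥0 → ℝ≥0) (a b : Label T D) :
    onLabelPairs (p ∘ Prod.swap) a b = onLabelPairs p b a := by
  rcases a with x | i <;> rcases b with y | j <;> rfl

theorem onLabelPairs_add (p q : ℝ≥0 × ℝ≥0 → ℝ≥0) :
    onLabelPairs (p + q) = (onLabelPairs p + onLabelPairs q : Label T D → Label T D → ℝ≥0) := by
  funext a b
  rcases a with x | i <;> rcases b with y | j <;> simp [onLabelPairs, onLabels]

theorem onLabelPairs_single {x y : ℝ≥0} (hx : x ∈ T) (hy : y ∈ T) (c : ℝ≥0) :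
    onLabelPairs (Finsupp.single (x, y) c) =
      (Pi.single (Sum.inl ⟨x, hx⟩) (Pi.single (Sum.inl ⟨y, hy⟩) c) :
        Label T D → Label T D → ℝ≥0) := by
  funext a b
  rcases a with x' | i <;> rcases b with y' | j <;>
    simp [onLabelPairs, onLabels, Finsupp.single_apply, Pi.single_apply, ite_apply, ite_and,
      Subtype.ext_iff, eq_comm]

theorem eventually_isLineStep_onLabelPairs {p q : ℝ≥0 × ℝ≥0 → ℝ≥0}
    (hpq : ∀ x, EBMLine (fun y => p (x, y)) (fun y => q (x, y)))
    (hp : ∀ x y, p (x, y) ≠ 0 → y ∈ T) (hq : ∀ x y, q (x, y) ≠ 0 → y ∈ T) :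
    ∀ᶠ D : ℕ in Filter.atTop, ∀ a : Label T D, ∃ U : Matrix (Label T D) (Label T D) ℂ,
      IsLineStep Label.value (onLabelPairs p a) (onLabelPairs q a) U := by
  have hlines := (Filter.eventually_all_finset T).mpr fun x _ =>
    (hpq x).eventually_isLineStep (hp x) (hq x)
  filter_upwards [hlines] with D hD
  rintro (x | j)
  · exact hD x x.2
  · exact ⟨1, IsLineStep.refl Label.value_nonneg _⟩

variable {n : ℕ} {p : ℕ → (ℝ≥0 × ℝ≥0 →₀ ℝ≥0)} {β α : ℝ≥0}

theorem exists_finset_coordinates (n : ℕ) (p : ℕ → (ℝ≥0 × ℝ≥0 →₀ ℝ≥0)) :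
    ∃ T : Finset ℝ≥0, ∀ k ≤ n, ∀ x y, p k (x, y) ≠ 0 → x ∈ T ∧ y ∈ T := by
  let S := (Finset.range (n + 1)).biUnion fun k => (p k).support
  refine ⟨S.image Prod.fst ∪ S.image Prod.snd, fun k hk x y hxy => ?_⟩
  have hS : (x, y) ∈ S := Finset.mem_biUnion.mpr
    ⟨k, Finset.mem_range_succ_iff.mpr hk, Finsupp.mem_support_iff.mpr hxy⟩
  exact ⟨Finset.mem_union_left _ (Finset.mem_image_of_mem _ hS),
    Finset.mem_union_right _ (Finset.mem_image_of_mem _ hS)⟩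

theorem IsEBMPointGame.eventually_isLineStep (hp : IsEBMPointGame n p β α)
    (hT : ∀ k ≤ n, ∀ x y, p k (x, y) ≠ 0 → x ∈ T ∧ y ∈ T) :
    ∀ᶠ D : ℕ in Filter.atTop, ∀ k ∈ Finset.range n, ∀ c : Label T D,
      ∃ U : Matrix (Label T D) (Label T D) ℂ,
        (Even k → IsLineStep Label.value (onLabelPairs (p k) c) (onLabelPairs (p (k + 1)) c) U) ∧
        (Odd k → IsLineStep Label.value (fun a => onLabelPairs (p k) a c)
          (fun a => onLabelPairs (p (k + 1)) a c) U) := by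
  refine (Filter.eventually_all_finset _).mpr fun k hk => ?_
  have hk : k < n := Finset.mem_range.mp hk
  rcases Nat.even_or_odd k with hk_even | hk_odd
  · filter_upwards [eventually_isLineStep_onLabelPairs (hp.vertical k hk hk_even)
      (fun x y h => (hT k hk.le x y h).2) fun x y h => (hT _ hk x y h).2] with D hD c
    obtain ⟨U, hU⟩ := hD c
    exact ⟨U, fun _ => hU, fun hk_odd => absurd hk_even (Nat.not_even_iff_odd.mpr hk_odd)⟩
  · filter_upwards [eventually_isLineStep_onLabelPairs (p := p k ∘ Prod.swap)
      (q := p (k + 1) ∘ Prod.swap) (hp.horizontal k hk hk_odd)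
      (fun y x h => (hT k hk.le x y h).1) fun y x h => (hT _ hk x y h).1] with D hD c
    obtain ⟨U, hU⟩ := hD c
    simp only [funext (onLabelPairs_comp_swap _ c)] at hU
    exact ⟨U, fun hk_even => absurd hk_even (Nat.not_even_iff_odd.mpr hk_odd), fun _ => hU⟩

/- Past `n` the game is prolonged by trivial steps, as a protocol has an even number of messages. -/
theorem IsEBMPointGame.exists_isLineStep_min (hp : IsEBMPointGame n p β α)
    (hT : ∀ k ≤ n, ∀ x y, p k (x, y) ≠ 0 → x ∈ T ∧ y ∈ T) :
    ∃ D : ℕ, ∀ k (c : Label T D), ∃ U : Matrix (Label T D) (Label T D) ℂ,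
      (Even k → IsLineStep Label.value (onLabelPairs (p (min k n)) c)
        (onLabelPairs (p (min (k + 1) n)) c) U) ∧
      (Odd k → IsLineStep Label.value (fun a => onLabelPairs (p (min k n)) a c)
        (fun a => onLabelPairs (p (min (k + 1) n)) a c) U) := by
  obtain ⟨D, hD⟩ := (hp.eventually_isLineStep hT).exists
  refine ⟨D, fun k c => ?_⟩
  rcases lt_or_ge k n with hk | hk
  · rw [min_eq_left hk.le, min_eq_left (Nat.succ_le_of_lt hk)]
    exact hD k (Finset.mem_range.mpr hk) c
  · rw [min_eq_right hk, min_eq_right (Nat.le_succ_of_le hk)]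
    exact ⟨1, fun _ => IsLineStep.refl Label.value_nonneg _,
      fun _ => IsLineStep.refl Label.value_nonneg _⟩

theorem IsEBMPointGame.exists_labelGame (hp : IsEBMPointGame n p β α) :
    ∃ (T : Finset ℝ≥0) (D : ℕ) (G : LabelGame (Label T D)),
      G.value G.fst = β ∧ G.value G.snd = α := by
  obtain ⟨T, hT⟩ := exists_finset_coordinates n p
  obtain ⟨D, hsteps⟩ := hp.exists_isLineStep_min hT
  choose U hU using hsteps
  have hinit := hT 0 (Nat.zero_le n)
  rw [hp.init] at hinit
  obtain ⟨h0, h1⟩ := hinit 0 1 (by simp)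
  obtain ⟨hβ, hα⟩ := hT n le_rfl β α (by simp [hp.final])
  exact ⟨T, D,
    { N := 2 * n
      value := Label.value
      weight := fun k => onLabelPairs (p (min k n))
      unitary := U
      zero := Sum.inl ⟨0, h0⟩
      one := Sum.inl ⟨1, h1⟩
      fst := Sum.inl ⟨β, hβ⟩
      snd := Sum.inl ⟨α, hα⟩
      even := even_two_mul n
      value_nonneg := Label.value_nonneg
      value_zero := NNReal.coe_zero
      value_one := NNReal.coe_one
      vertical := fun k _ hk a => (hU k a).1 hk
      horizontal := fun k _ hk b => (hU k b).2 hk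
      init := by
        rw [Nat.zero_min, hp.init, Finsupp.coe_add, onLabelPairs_add, onLabelPairs_single h0 h1,
          onLabelPairs_single h1 h0]
      final := by
        rw [min_eq_right (Nat.le_mul_of_pos_left n two_pos), hp.final, onLabelPairs_single hβ hα] },
    rfl, rfl⟩

end PointGame

end WCF

theorem mainTheorem3 (n : ℕ) (p : ℕ → (ℝ≥0 × ℝ≥0 →₀ ℝ≥0)) (β α : ℝ≥0)
    (hp : WCF.IsEBMPointGame n p β α) :
    ∃ (A M B : Type) (_ : Fintype A) (_ : Fintype M) (_ : Fintype B)
      (_ : DecidableEq A) (_ : DecidableEq M) (_ : DecidableEq B)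
      (N : ℕ) (P : WCF.Scheme A M B) (ZA : ℕ → Matrix A A ℂ) (ZB : ℕ → Matrix B B ℂ),
      P.IsProtocol N ∧
      P.DualFeasibleA N ZA (β : ℝ) ∧ P.DualFeasibleB N ZB (α : ℝ) ∧
      P.cheatA N ≤ ((α : ℝ) : EReal) ∧ P.cheatB N ≤ ((β : ℝ) : EReal) ∧
      P.primalValueA N ≤ ((α : ℝ) : EReal) ∧ P.primalValueB N ≤ ((β : ℝ) : EReal) := by
  obtain ⟨T, D, G, hβ, hα⟩ := hp.exists_labelGame
  have hP := G.isProtocol_scheme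
  have hZA := G.dualFeasibleA_scheme
  have hZB := G.dualFeasibleB_scheme
  rw [hβ] at hZA
  rw [hα] at hZB
  have hA := hP.primalValueA_le hZB
  have hB := hP.primalValueB_le hZA
  exact ⟨_, _, _, _, _, _, _, _, _, G.N, G.scheme, _, _, hP, hZA, hZB,
    hP.cheatA_le_primalValueA.trans hA, hP.cheatB_le_primalValueB.trans hB, hA, hB⟩
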